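/- **Setting.** Let $\mathcal{L}_{\rm DP}$ be the three-sorted language of Denef–Pas: the ring language on the valued field sort $\mathrm{VF}$ and on the residue field sort $\mathrm{RF}$, the language $(+,<)$ on the value group sort $\mathrm{VG}$, the valuation $\operatorname{ord}$ from $\mathrm{VF}\setminus\{0\}$ to $\mathrm{VG}$ (with $\operatorname{ord}(0)=0$ by convention where a total function symbol is needed), and an angular component map $\overline{\rm ac}:\mathrm{VF}\to\mathrm{RF}$. Let $\mathcal{L}\supseteq\mathcal{L}_{\rm DP}$ be a language with the same sorts, and let $\mathcal{T}$ be an $\mathcal{L}$-theory containing the theory $H_{\overline{\rm ac},0}$ of henselian valued fields with angular component and residue field of characteristic zero. Assume that $\mathcal{T}$ has the following properties $(*)$ and $(**)$. $(*)$ For every model $\mathcal{K}=(K,k,\Gamma)$ of $\mathcal{T}$: 1. (*split*) every $\mathcal{K}$-definable subset of $\Gamma^r$ is $\Gamma$-definable in the language $(+,<)$; and for every finite set $A$ of elements of the sorts of $\mathcal{K}$, every $A$-definable subset of $k^s\times\Gamma^r$ is a finite disjoint union of sets $Y_i\times Z_i$ with $Y_i\subset k^s$ and $Z_i\subset\Gamma^r$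 both $A$-definable; 2. (*finite b-minimality*) every locally constant $\mathcal{K}$-definable function $K^\times\to K$ has finite image; and for every finite $A\subset K$ and every $A$-definable $X\subset K$ there are $r,t\ge 0$ and $A$-definable functions $f:X\to S$ and $c:S\to K$, with $S=k^r\times\Gamma^t$, such that each nonempty fiber $f^{-1}(s)$ is either $\{c(s)\}$ or of the form $\{x\in K : \overline{\rm ac}(x-c(s))=\xi,\ \operatorname{ord}(x-c(s))=\eta\}$ for some $\xi\in k$, $\eta\in\Gamma$; 3. (*Jacobian property*) for every finite set $A$ of elements of the sorts of $\mathcal{K}$ and every $A$-definable $F:K\to K$ there is an $A$-definable $f:K\to S$, with $S$ a product of sorts other than $\mathrm{VF}$, such that each infinite fiber $B$ of $f$ is a ball $\{x:\operatorname{ord}(x-a)>\gamma\}$ on which $F$ is either constant or has the Jacobian property: $F$ maps $B$ bijectively onto a ball of this form, is $C^1$ on $B$ with nonvanishing derivative $F'$, $\operatorname{ord}(F')$ and $\overline{\rm ac}(F')$ are constant on $B$, and $\operatorname{ord}(F')+\operatorname{ord}(x-y)=\operatorname{ord}(F(x)-F(y))$ and $\overline{\rm ac}(F')\,\overline{\rm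 ac}(x-y)=\overline{\rm ac}(F(x)-F(y))$ for all $x,y\in B$. $(**)$ All non-archimedean local fields $K$ are equipped with $\mathcal{L}$-structure, expanding the $\mathcal{L}_{\rm DP}$-structure on $(K,k_K,\mathbb{Z})$ given by the normalized valuation and by $\overline{\rm ac}(x)=x\varpi^{-\operatorname{ord}x}\bmod\mathcal{M}_K$ (and $\overline{\rm ac}(0)=0$) for a uniformizer $\varpi$ of $K$, in such a way that every finite subset of $\mathcal{T}$ holds in all local fields of large enough residue field characteristic. **Balls and multiboxes.** Let $K$ be a local field with valuation ring $\mathcal{O}_K$. A ball in $K$ is a set $a+b\mathcal{O}_K$ with $a,b\in K$, $b\neq0$; volumes are taken for the Haar measure on $K$ giving $\mathcal{O}_K$ measure $1$. For $Y_0\subset\mathcal{O}_K$, the multibox $MB(Y_0)$ is the union of those sets $Y\subset Y_0$ that are a ball or a singleton and whose volume is maximal among all balls and singletons contained in $Y_0$ (singletons have volume $0$). **Lemma.** Let $Z$ (a subset of a finite product of sorts) and $X\subset\mathrm{VF}\times Z$ be definable by $\mathcal{L}$-formulas, such that $X_K\subset\mathcal{O}_K\times Z_K$ for all local fields $K$ of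 large residue field characteristic. Then there exist positive integers $M$ and $Q$ such that, for all local fields $K$ with residue field characteristic at least $M$ and for all $z\in Z_K$, one has $$N_{K,z}\le Q,$$ where, with $X_{K,z}=\{x\in\mathcal{O}_K\mid(x,z)\in X_K\}$, $N_{K,z}$ is the number of balls $B$ in $K$ that have minimal volume among the balls $B$ satisfying $$B\cap MB(X_{K,z})\neq\emptyset\quad\text{and}\quad B\nsubseteq MB(X_{K,z})$$ (in particular $N_{K,z}=0$ if no minimum is attained). -/

import Mathlib

open scoped ValuativeRel WithZero ENNReal

universe u

noncomputable section

namespace DPas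

/-! ## Three-sorted first-order logic -/

/-- The sorts: valued field, residue field, value group. -/
inductive Srt : Type
  | VF
  | RF
  | VG

/-- A first-order language with sorts `VF`, `RF`, `VG`: function symbols with a list of argument
sorts and a value sort, and relation symbols with a list of argument sorts. -/
structure Lang : Type (u + 1) where
  Fn : List Srt → Srt → Type u
  Rel : List Srt → Type u

/-- The carriers of the three sorts. -/
def Carrier (K k Γ : Type u) : Srt → Type u
  | .VF => K
  | .RF => k
  | .VG => Γ

/-- Elements of a Cartesian product of sorts. -/
abbrev Tuple (C : Srt → Type u) (l : List Srt) : Type u := ∀ i : Fin l.length, C (l.get i)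

namespace Tuple

variable {C : Srt → Type u}

def nil : Tuple C [] := fun i => i.elim0

def cons {s : Srt} {l : List Srt} (x : C s) (t : Tuple C l) : Tuple C (s :: l) :=
  fun i => Fin.cases (motive := fun i : Fin (l.length + 1) => C ((s :: l).get i)) x t i

def append : {l m : List Srt} → Tuple C l → Tuple C m → Tuple C (l ++ m)
  | [], _, _, b => b
  | _ :: _, _, a, b => cons (a ⟨0, Nat.succ_pos _⟩) (append (fun i => a i.succ) b)

end Tuple

/-- Terms with variables from the context `ctx` and value in a given sort. -/
inductive Term (L : Lang.{u}) (ctx : List Srt) : Srt → Type u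
  | var (i : Fin ctx.length) : Term L ctx (ctx.get i)
  | app {a : List Srt} {s : Srt} (f : L.Fn a s)
      (ts : ∀ i : Fin a.length, Term L ctx (a.get i)) : Term L ctx s

/-- First-order formulas with free variables from the context. The quantifier `all s` binds a new
variable of sort `s`, put in front of the context. -/
inductive Formula (L : Lang.{u}) : List Srt → Type u
  | falsum {ctx : List Srt} : Formula L ctx
  | eq {ctx : List Srt} {s : Srt} (t₁ t₂ : Term L ctx s) : Formula L ctx
  | rel {ctx a : List Srt} (R : L.Rel a)
      (ts : ∀ i : Fin a.length, Term L ctx (a.get i)) : Formula L ctx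
  | imp {ctx : List Srt} (φ ψ : Formula L ctx) : Formula L ctx
  | all {ctx : List Srt} (s : Srt) (φ : Formula L (s :: ctx)) : Formula L ctx

/-- Sentences are formulas without free variables. -/
abbrev Sentence (L : Lang.{u}) : Type u := Formula L []

/-- An `L`-structure on the triple of carriers `(K, k, Γ)`. -/
@[ext]
structure Interp (L : Lang.{u}) (K k Γ : Type u) : Type u where
  fn : ∀ {a : List Srt} {s : Srt}, L.Fn a s → Tuple (Carrier K k Γ) a → Carrier K k Γ s
  rel : ∀ {a : List Srt}, L.Rel a → Tuple (Carrier K k Γ) a → Prop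

section Semantics

variable {L : Lang.{u}} {K k Γ : Type u} (M : Interp L K k Γ)

def Term.eval {ctx : List Srt} (v : Tuple (Carrier K k Γ) ctx) :
    {s : Srt} → Term L ctx s → Carrier K k Γ s
  | _, .var i => v i
  | _, .app f ts => M.fn f (fun i => (ts i).eval v)

def Formula.Realize : {ctx : List Srt} → Formula L ctx → Tuple (Carrier K k Γ) ctx → Prop
  | _, .falsum, _ => False
  | _, .eq t₁ t₂, v => t₁.eval M v = t₂.eval M v
  | _, .rel R ts, v => M.rel R (fun i => (ts i).eval M v)
  | _, .imp φ ψ, v => φ.Realize v → ψ.Realize v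
  | _, .all s φ, v => ∀ x : Carrier K k Γ s, φ.Realize (Tuple.cons x v)

/-- `M` is a model of the theory `T`. -/
def Interp.Models (T : Set (Sentence L)) : Prop := ∀ σ ∈ T, Formula.Realize M σ Tuple.nil

/-- `X` is definable in `M` with parameters from the finite tuple `a`. (A finite set of parameters
is given by a tuple listing its elements.) -/
def Interp.DefinableOver {m : List Srt} (a : Tuple (Carrier K k Γ) m) {l : List Srt}
    (X : Set (Tuple (Carrier K k Γ) l)) : Prop :=
  ∃ φ : Formula L (l ++ m), ∀ x, x ∈ X ↔ Formula.Realize M φ (x.append a)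

/-- `X` is definable in `M` with arbitrary parameters. -/
def Interp.Definable {l : List Srt} (X : Set (Tuple (Carrier K k Γ) l)) : Prop :=
  ∃ (m : List Srt) (a : Tuple (Carrier K k Γ) m), M.DefinableOver a X

end Semantics

/-! ## The language of Denef-Pas and its standard structures -/

/-- Function symbols of the language of Denef-Pas: the language of rings on `VF` and on `RF`,
addition on `VG`, the valuation and the angular component. -/
inductive DPFn : List Srt → Srt → Type
  | zeroK : DPFn [] .VF
  | oneK : DPFn [] .VF
  | addK : DPFn [.VF, .VF] .VF
  | negK : DPFn [.VF] .VF
  | mulK : DPFn [.VF, .VF] .VF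
  | zeroR : DPFn [] .RF
  | oneR : DPFn [] .RF
  | addR : DPFn [.RF, .RF] .RF
  | negR : DPFn [.RF] .RF
  | mulR : DPFn [.RF, .RF] .RF
  | addG : DPFn [.VG, .VG] .VG
  | ord : DPFn [.VF] .VG
  | ac : DPFn [.VF] .RF

/-- Relation symbols of the language of Denef-Pas (besides equality). -/
inductive DPRel : List Srt → Type
  | lt : DPRel [.VG, .VG]

/-- The language of Denef-Pas `(L_ring, L_ring, L_oag, ord, ac)`. -/
def LDP : Lang.{0} := ⟨DPFn, DPRel⟩

/-- The language `L_DP ∪ E`, for an arbitrary collection `E` of additional symbols: this is the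
general form of a language containing `L_DP` with the same sorts. -/
def DPLang (E : Lang.{u}) : Lang.{u} where
  Fn a s := LDP.Fn a s ⊕ E.Fn a s
  Rel a := LDP.Rel a ⊕ E.Rel a

/-- A valued field `K` with valuation onto `Γ` (and `v 0 = ⊤`), with residue field `k` (through the
reduction map `res` from the valuation ring, whose kernel is then the maximal ideal), and with an
angular component map `ac : K → k`. -/
structure AcValued (K k Γ : Type*) [Field K] [Field k] [AddCommGroup Γ] [LinearOrder Γ]
    [IsOrderedAddMonoid Γ] where
  v : AddValuation K (WithTop Γ)
  exists_v_eq : ∀ γ : Γ, ∃ x : K, v x = γ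
  res : v.toValuation.integer →+* k
  res_surjective : Function.Surjective res
  ac : K →*₀ k
  ac_eq_res : ∀ x : v.toValuation.integer, v (x : K) = 0 → ac x = res x

section Standard

variable {K k Γ : Type u} [Field K] [Field k] [AddCommGroup Γ] [LinearOrder Γ]
  [IsOrderedAddMonoid Γ]

/-- The valuation ring `{x | 0 ≤ v x}`. -/
abbrev AcValued.integers (V : AcValued K k Γ) : Subring K := V.v.toValuation.integer

theorem AcValued.mem_integers (V : AcValued K k Γ) (x : K) : x ∈ V.integers ↔ 0 ≤ V.v x := Iff.rfl

/-- Interpretation of the function symbols of `L_DP`. Function symbols being total, the value of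
`ord` at `0` is set to be `0` by convention. -/
def AcValued.fn (V : AcValued K k Γ) : {a : List Srt} → {s : Srt} → DPFn a s →
    Tuple (Carrier K k Γ) a → Carrier K k Γ s
  | _, _, .zeroK, _ => (0 : K)
  | _, _, .oneK, _ => (1 : K)
  | _, _, .addK, x => (· + · : K → K → K) (x (0 : Fin 2)) (x (1 : Fin 2))
  | _, _, .negK, x => (- · : K → K) (x (0 : Fin 1))
  | _, _, .mulK, x => (· * · : K → K → K) (x (0 : Fin 2)) (x (1 : Fin 2))
  | _, _, .zeroR, _ => (0 : k)
  | _, _, .oneR, _ => (1 : k)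
  | _, _, .addR, x => (· + · : k → k → k) (x (0 : Fin 2)) (x (1 : Fin 2))
  | _, _, .negR, x => (- · : k → k) (x (0 : Fin 1))
  | _, _, .mulR, x => (· * · : k → k → k) (x (0 : Fin 2)) (x (1 : Fin 2))
  | _, _, .addG, x => (· + · : Γ → Γ → Γ) (x (0 : Fin 2)) (x (1 : Fin 2))
  | _, _, .ord, x => WithTop.untopD (0 : Γ) (V.v (x (0 : Fin 1)))
  | _, _, .ac, x => V.ac (x (0 : Fin 1))

/-- Interpretation of the relation symbols of `L_DP`. -/
def AcValued.rel (_V : AcValued K k Γ) : {a : List Srt} → DPRel a → Tuple (Carrier K k Γ) a → Prop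
  | _, .lt, x => (· < · : Γ → Γ → Prop) (x (0 : Fin 2)) (x (1 : Fin 2))

/-- The `L_DP`-structure `M` restricts to on `(K, k, Γ)` is that of the valued field with angular
component `V`. -/
def Interp.Expands {E : Lang.{u}} (M : Interp (DPLang E) K k Γ) (V : AcValued K k Γ) : Prop :=
  (∀ (a : List Srt) (s : Srt) (f : DPFn a s) (x : Tuple (Carrier K k Γ) a),
    M.fn (Sum.inl f : (DPLang E).Fn a s) x = V.fn f x) ∧
  (∀ (a : List Srt) (R : DPRel a) (x : Tuple (Carrier K k Γ) a),
    M.rel (Sum.inl R : (DPLang E).Rel a) x ↔ V.rel R x)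

end Standard

/-- `T` contains the theory `H_{ac,0}` of henselian valued fields with angular component and with
residue field of characteristic zero. That class of structures being elementary, this is stated as:
all models of `T` belong to it. -/
def ContainsH {E : Lang.{u}} (T : Set (Sentence (DPLang E))) : Prop :=
  ∀ (K k Γ : Type u) (M : Interp (DPLang E) K k Γ), M.Models T →
    ∃ (_ : Field K) (_ : Field k) (_ : AddCommGroup Γ) (_ : LinearOrder Γ)
      (_ : IsOrderedAddMonoid Γ) (V : AcValued K k Γ),
      M.Expands V ∧ HenselianLocalRing V.integers ∧ CharZero k

/-! ## Property (∗) -/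

section Star

variable {K k Γ : Type u} [Field K] [Field k] [AddCommGroup Γ] [LinearOrder Γ]
  [IsOrderedAddMonoid Γ]

/-- Balls `{x | ord (x - a) > γ}` in a valued field. -/
def AcValued.IsOpenBall (V : AcValued K k Γ) (B : Set K) : Prop :=
  ∃ (a : K) (γ : Γ), B = {x | (γ : WithTop Γ) < V.v (x - a)}

/-- `F` is differentiable at `x`, within `B`, with derivative `d`: the difference quotient tends to
`d` for the valuation topology. -/
def AcValued.HasDerivWithin (V : AcValued K k Γ) (F : K → K) (B : Set K) (x d : K) : Prop :=
  ∀ ε : Γ, ∃ δ : Γ, ∀ y ∈ B, y ≠ x → (δ : WithTop Γ) < V.v (y - x) →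
    (ε : WithTop Γ) < V.v ((F y - F x) / (y - x) - d)

/-- Continuity on `B` for the valuation topology. -/
def AcValued.ContOn (V : AcValued K k Γ) (F : K → K) (B : Set K) : Prop :=
  ∀ x ∈ B, ∀ ε : Γ, ∃ δ : Γ, ∀ y ∈ B, (δ : WithTop Γ) < V.v (y - x) →
    (ε : WithTop Γ) < V.v (F y - F x)

/-- The Jacobian property of the restriction of `F` to `B`. -/
def AcValued.HasJacobianProperty (V : AcValued K k Γ) (F : K → K) (B : Set K) : Prop :=
  V.IsOpenBall B ∧ (∃ B' : Set K, V.IsOpenBall B' ∧ Set.BijOn F B B') ∧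
  ∃ F' : K → K,
    (∀ x ∈ B, V.HasDerivWithin F B x (F' x)) ∧ V.ContOn F' B ∧
    (∀ x ∈ B, F' x ≠ 0) ∧
    (∀ x ∈ B, ∀ y ∈ B, V.v (F' x) = V.v (F' y) ∧ V.ac (F' x) = V.ac (F' y)) ∧
    (∀ x ∈ B, ∀ y ∈ B, V.v (F' x) + V.v (x - y) = V.v (F x - F y) ∧
      V.ac (F' x) * V.ac (x - y) = V.ac (F x - F y))

/-- The graph over `X` of `f : K → S`, where `S` is a Cartesian product of sorts. -/
def graphFrom (k Γ : Type u) {l : List Srt} (X : Set K) (f : K → Tuple (Carrier K k Γ) l) :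
    Set (Tuple (Carrier K k Γ) (.VF :: l)) :=
  {p | ∃ x ∈ X, p = Tuple.cons (s := .VF) x (f x)}

/-- The graph of `c : S → K`, where `S` is a Cartesian product of sorts. -/
def graphTo {l : List Srt} (c : Tuple (Carrier K k Γ) l → K) :
    Set (Tuple (Carrier K k Γ) (.VF :: l)) :=
  {p | ∃ s, p = Tuple.cons (s := .VF) (c s) s}

/-- The tuple with one coordinate `x` in the valued field. -/
def single (k Γ : Type u) (x : K) : Tuple (Carrier K k Γ) [.VF] := Tuple.cons (s := .VF) x Tuple.nil

/-- The graph over `X` of `F : K → K`. -/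
def graphVF (k Γ : Type u) (X : Set K) (F : K → K) : Set (Tuple (Carrier K k Γ) [.VF, .VF]) :=
  graphFrom k Γ X (fun x => single k Γ (F x))

variable {E : Lang.{u}}

/-- The Jacobian property in one model. -/
def JacobianIn (V : AcValued K k Γ) (M : Interp (DPLang E) K k Γ) : Prop :=
  ∀ (m : List Srt) (a : Tuple (Carrier K k Γ) m) (F : K → K),
    M.DefinableOver a (graphVF k Γ Set.univ F) →
    ∃ (l : List Srt) (f : K → Tuple (Carrier K k Γ) l), (∀ s ∈ l, s ≠ .VF) ∧
      M.DefinableOver a (graphFrom k Γ Set.univ f) ∧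
      ∀ s, (f ⁻¹' {s}).Infinite → V.IsOpenBall (f ⁻¹' {s}) ∧
        ((∃ b, ∀ x ∈ f ⁻¹' {s}, F x = b) ∨ V.HasJacobianProperty F (f ⁻¹' {s}))

/-- Finite b-minimality in one model. The finite set of parameters in the second part lies in the
valued field; `S` is `k ^ r × Γ ^ t`. -/
def FinitelyBMinimalIn (V : AcValued K k Γ) (M : Interp (DPLang E) K k Γ) : Prop :=
  (∀ g : K → K, M.Definable (graphVF k Γ {x | x ≠ 0} g) →
    (∀ x : K, x ≠ 0 → ∃ γ : Γ, ∀ y : K, y ≠ 0 → (γ : WithTop Γ) < V.v (y - x) → g y = g x) →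
    (g '' {x | x ≠ 0}).Finite) ∧
  ∀ (m : ℕ) (a : Tuple (Carrier K k Γ) (List.replicate m .VF)) (X : Set K),
    M.DefinableOver a ((single k Γ) '' X) →
    ∃ (r t : ℕ) (f : K → Tuple (Carrier K k Γ) (List.replicate r .RF ++ List.replicate t .VG))
      (c : Tuple (Carrier K k Γ) (List.replicate r .RF ++ List.replicate t .VG) → K),
      M.DefinableOver a (graphFrom k Γ X f) ∧ M.DefinableOver a (graphTo c) ∧
      ∀ s, (X ∩ f ⁻¹' {s}).Nonempty →
        X ∩ f ⁻¹' {s} = {c s} ∨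
        ∃ (ξ : k) (η : Γ),
          X ∩ f ⁻¹' {s} = {x | x ≠ c s ∧ V.ac (x - c s) = ξ ∧ V.v (x - c s) = (η : WithTop Γ)}

end Star

/-- Function symbols of the (one-sorted) language of ordered abelian groups. -/
inductive OagFn : ℕ → Type
  | add : OagFn 2

/-- Relation symbols of the language of ordered abelian groups. -/
inductive OagRel : ℕ → Type
  | lt : OagRel 2

/-- The language `(+, <)` of ordered abelian groups. -/
def oag : FirstOrder.Language := ⟨OagFn, OagRel⟩

instance oagStructure (Γ : Type u) [Add Γ] [LT Γ] : oag.Structure Γ where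
  funMap := fun {_} f => match f with
    | .add => fun x => x 0 + x 1
  RelMap := fun {_} R => match R with
    | .lt => fun x => x 0 < x 1

/-- Elements of `Γ ^ r` as tuples of sort `VG`. -/
def vgTuple (K k : Type u) {Γ : Type u} : {r : ℕ} → (Fin r → Γ) →
    Tuple (Carrier K k Γ) (List.replicate r .VG)
  | 0, _ => Tuple.nil
  | _ + 1, g => Tuple.cons (s := .VG) (g 0) (vgTuple K k (fun i => g i.succ))

/-- The two conditions for being split, in one model. -/
def SplitIn {K k Γ : Type u} [Add Γ] [LT Γ] {E : Lang.{u}} (M : Interp (DPLang E) K k Γ) : Prop :=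
  (∀ (r : ℕ) (X : Set (Fin r → Γ)), M.Definable (vgTuple K k '' X) →
    (Set.univ : Set Γ).Definable oag X) ∧
  ∀ (m : List Srt) (a : Tuple (Carrier K k Γ) m) (s r : ℕ)
    (X : Set (Tuple (Carrier K k Γ) (List.replicate s .RF ++ List.replicate r .VG))),
    M.DefinableOver a X →
    ∃ (n : ℕ) (Y : Fin n → Set (Tuple (Carrier K k Γ) (List.replicate s .RF)))
      (Z : Fin n → Set (Tuple (Carrier K k Γ) (List.replicate r .VG))),
      (∀ i, M.DefinableOver a (Y i)) ∧ (∀ i, M.DefinableOver a (Z i)) ∧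
      (Pairwise fun i j => Disjoint (Set.image2 Tuple.append (Y i) (Z i))
        (Set.image2 Tuple.append (Y j) (Z j))) ∧
      X = ⋃ i, Set.image2 Tuple.append (Y i) (Z i)

/-- Property (∗): `T` is split, finitely b-minimal, and has the Jacobian property. It is meant for
theories containing `H_{ac,0}`, whose models all are valued fields with angular component. -/
def PropertyStar {E : Lang.{u}} (T : Set (Sentence (DPLang E))) : Prop :=
  ∀ (K k Γ : Type u) [Field K] [Field k] [AddCommGroup Γ] [LinearOrder Γ] [IsOrderedAddMonoid Γ]
    (V : AcValued K k Γ) (M : Interp (DPLang E) K k Γ), M.Expands V → M.Models T →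
    SplitIn M ∧ FinitelyBMinimalIn V M ∧ JacobianIn V M

/-! ## Local fields and property (∗∗) -/

section LocalField

variable (K : Type u) [Field K] [ValuativeRel K] [TopologicalSpace K] [IsNonarchimedeanLocalField K]

open ValuativeRel

instance : IsOrderedAddMonoid (ULift.{u} ℤ) where
  add_le_add_left a b h c := by
    rw [← ULift.down_le] at h ⊢
    exact add_le_add_left h c.down

/-- The integers, in a form suitable as values of an additive valuation. The copy `ULift ℤ` of `ℤ`
only serves to have the three sorts in one universe. -/
abbrev toVal (n : ℤ) : WithTop (ULift.{u} ℤ) := WithTop.some (ULift.up n)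

/-- The normalized (integer-valued) order of a nonzero element of a local field (and the junk value
`0` at `0`). -/
def ordZ (x : K) : ℤ :=
  -WithZero.log (IsNonarchimedeanLocalField.valueGroupWithZeroIsoInt K (valuation K x))

/-- The normalized order on a local field, with value `⊤` at `0`. -/
def localOrd (x : K) : WithTop (ULift.{u} ℤ) :=
  open Classical in if x = 0 then ⊤ else toVal (ordZ K x)

theorem localOrd_zero : localOrd K 0 = ⊤ := by simp [localOrd]

theorem localOrd_of_ne {x : K} (hx : x ≠ 0) :
    localOrd K x = toVal (ordZ K x) := by simp [localOrd, hx]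

theorem iso_ne_zero {x : K} (hx : x ≠ 0) :
    IsNonarchimedeanLocalField.valueGroupWithZeroIsoInt K (valuation K x) ≠ 0 := by
  simpa using hx

theorem ordZ_mul {x y : K} (hx : x ≠ 0) (hy : y ≠ 0) : ordZ K (x * y) = ordZ K x + ordZ K y := by
  rw [ordZ, ordZ, ordZ, map_mul, map_mul,
    WithZero.log_mul (iso_ne_zero K hx) (iso_ne_zero K hy), neg_add]

theorem ordZ_zpow (x : K) (n : ℤ) : ordZ K (x ^ n) = n * ordZ K x := by
  rw [ordZ, ordZ, map_zpow₀, map_zpow₀, WithZero.log_zpow, smul_eq_mul, mul_neg]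

theorem ordZ_one : ordZ K 1 = 0 := by simp [ordZ]

theorem localOrd_le_iff (x y : K) : localOrd K x ≤ localOrd K y ↔
    valuation K y ≤ valuation K x := by
  by_cases hy : y = 0
  · subst hy; simp [localOrd_zero]
  by_cases hx : x = 0
  · subst hx; simp [localOrd_zero, localOrd_of_ne K hy, hy]
  rw [localOrd_of_ne K hx, localOrd_of_ne K hy, WithTop.coe_le_coe, ULift.up_le, ordZ, ordZ,
    neg_le_neg_iff, WithZero.log_le_log (iso_ne_zero K hy) (iso_ne_zero K hx), map_le_map_iff]

/-- The normalized valuation of a local field. -/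
def localVal : AddValuation K (WithTop (ULift.{u} ℤ)) :=
  AddValuation.of (localOrd K) (localOrd_zero K)
    (by rw [localOrd_of_ne K one_ne_zero, ordZ_one]; rfl)
    (fun x y => by
      rw [min_le_iff, localOrd_le_iff, localOrd_le_iff]
      rcases (valuation K).map_add' x y with h | h
      · exact Or.inl h
      · exact Or.inr h)
    (fun x y => by
      by_cases hx : x = 0
      · subst hx; simp [localOrd_zero]
      by_cases hy : y = 0
      · subst hy; simp [localOrd_zero]
      rw [localOrd_of_ne K hx, localOrd_of_ne K hy, localOrd_of_ne K (mul_ne_zero hx hy),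
        ← WithTop.coe_add, ordZ_mul K hx hy]
      rfl)

theorem localVal_of_ne {x : K} (hx : x ≠ 0) :
    localVal K x = toVal (ordZ K x) := localOrd_of_ne K hx

theorem mem_localVal_integer (x : K) : x ∈ (localVal K).toValuation.integer ↔ x ∈ 𝒪[K] := by
  have h := localOrd_le_iff K 1 x
  have h1 : localOrd K 1 = 0 := (localVal K).map_one
  rw [h1, map_one] at h
  exact h

theorem localVal_surjective (γ : ULift.{u} ℤ) : ∃ x : K, localVal K x = (γ : WithTop (ULift.{u} ℤ)) := by
  obtain ⟨x, hx⟩ := ValuativeRel.valuation_surjective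
    ((IsNonarchimedeanLocalField.valueGroupWithZeroIsoInt K).symm (WithZero.exp (-γ.down)))
  have hx0 : x ≠ 0 := by
    rintro rfl
    rw [map_zero] at hx
    have h := congrArg (IsNonarchimedeanLocalField.valueGroupWithZeroIsoInt K) hx
    rw [map_zero, OrderMonoidIso.apply_symm_apply] at h
    exact WithZero.exp_ne_zero h.symm
  refine ⟨x, ?_⟩
  rw [localVal_of_ne K hx0, ordZ, hx]
  simp

/-- The reduction map from the valuation ring to the residue field. -/
def localRes : (localVal K).toValuation.integer →+* 𝓀[K] :=
  (IsLocalRing.residue 𝒪[K]).comp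
    (Subring.inclusion (fun x hx => (mem_localVal_integer K x).1 hx))

theorem localRes_surjective : Function.Surjective (localRes K) := by
  intro y
  obtain ⟨x, rfl⟩ := IsLocalRing.residue_surjective y
  exact ⟨⟨x, (mem_localVal_integer K x).2 x.2⟩, rfl⟩

variable {K}

theorem mul_zpow_mem {ϖ : K} (hϖ : localVal K ϖ = toVal 1)
    (x : K) : x * ϖ ^ (-ordZ K x) ∈ 𝒪[K] := by
  by_cases hx : x = 0
  · subst hx; simp
  have h0 : ϖ ≠ 0 := by rintro rfl; simp at hϖ
  have h1 : ordZ K ϖ = 1 := by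
    rw [localVal_of_ne K h0] at hϖ
    exact congrArg ULift.down (WithTop.coe_injective hϖ)
  rw [← mem_localVal_integer]
  change (0 : WithTop (ULift.{u} ℤ)) ≤ localVal K _
  rw [localVal_of_ne K (mul_ne_zero hx (zpow_ne_zero _ h0)),
    ordZ_mul K hx (zpow_ne_zero _ h0), ordZ_zpow, h1, mul_one, add_neg_cancel]
  exact le_rfl

/-- The angular component map for the uniformizer `ϖ`: the reduction of `x ϖ ^ (- ord x)`. -/
def localAc {ϖ : K} (hϖ : localVal K ϖ = toVal 1) :
    K →*₀ 𝓀[K] where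
  toFun x := IsLocalRing.residue 𝒪[K] ⟨x * ϖ ^ (-ordZ K x), mul_zpow_mem hϖ x⟩
  map_zero' := by
    rw [← map_zero (IsLocalRing.residue 𝒪[K])]
    congr 1
    ext
    simp
  map_one' := by
    rw [← map_one (IsLocalRing.residue 𝒪[K])]
    congr 1
    ext
    simp [ordZ_one]
  map_mul' x y := by
    rw [← map_mul]
    congr 1
    ext
    by_cases hx : x = 0
    · subst hx; simp
    by_cases hy : y = 0
    · subst hy; simp
    have h0 : ϖ ≠ 0 := by rintro rfl; simp at hϖ
    simp only [MulMemClass.mk_mul_mk, ordZ_mul K hx hy, neg_add, zpow_add₀ h0]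
    ring

/-- The local field `K`, with its residue field and value group `ℤ`, and with the angular component
given by the uniformizer `ϖ`. -/
def localAcValued {ϖ : K} (hϖ : localVal K ϖ = toVal 1) :
    AcValued K 𝓀[K] (ULift.{u} ℤ) where
  v := localVal K
  exists_v_eq := localVal_surjective K
  res := localRes K
  res_surjective := localRes_surjective K
  ac := localAc hϖ
  ac_eq_res x hx := by
    have hx0 : (x : K) ≠ 0 := by intro h; rw [h] at hx; simp at hx
    have h1 : ordZ K (x : K) = 0 := by
      rw [localVal_of_ne K hx0] at hx
      exact congrArg ULift.down (WithTop.coe_injective hx)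
    change IsLocalRing.residue 𝒪[K] _ = IsLocalRing.residue 𝒪[K] _
    congr 1
    ext
    simp [h1]

end LocalField

/-- A way to equip the local field `K` with an `(L_DP ∪ E)`-structure: a uniformizer of `K`, and an
expansion of the corresponding `L_DP`-structure on `(K, k_K, ℤ)`. -/
structure LocalStructure (E : Lang.{u}) (K : Type u) [Field K] [ValuativeRel K]
    [TopologicalSpace K] [IsNonarchimedeanLocalField K] where
  ϖ : K
  uniformizer : localVal K ϖ = toVal 1
  interp : Interp (DPLang E) K 𝓀[K] (ULift.{u} ℤ)
  expands : interp.Expands (localAcValued uniformizer)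

/-- Every local field `K` is equipped with `(L_DP ∪ E)`-structure: `structures K` is the nonempty
set of the structures under consideration on `K`. (For instance a single one, or one for each choice
of a uniformizer.) -/
structure LocalEquipment (E : Lang.{u}) where
  structures : ∀ (K : Type u) [Field K] [ValuativeRel K] [TopologicalSpace K]
    [IsNonarchimedeanLocalField K], Set (LocalStructure E K)
  nonempty : ∀ (K : Type u) [Field K] [ValuativeRel K] [TopologicalSpace K]
    [IsNonarchimedeanLocalField K], (structures K).Nonempty

/-- Property (∗∗), for local fields equipped with structure by `𝔖`: each finite subtheory of `T`
holds in all local fields of large enough residue field characteristic. -/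
def PropertyStarStar {E : Lang.{u}} (T : Set (Sentence (DPLang E))) (𝔖 : LocalEquipment E) : Prop :=
  ∀ T' : Set (Sentence (DPLang E)), T' ⊆ T → T'.Finite → ∃ N : ℕ,
    ∀ (K : Type u) [Field K] [ValuativeRel K] [TopologicalSpace K] [IsNonarchimedeanLocalField K],
      N ≤ ringChar 𝓀[K] → ∀ S ∈ 𝔖.structures K, S.interp.Models T'

/-- The set in a local field defined by a formula. -/
def LocalStructure.points {E : Lang.{u}} {K : Type u} [Field K] [ValuativeRel K]
    [TopologicalSpace K] [IsNonarchimedeanLocalField K] (S : LocalStructure E K) {l : List Srt}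
    (φ : Formula (DPLang E) l) : Set (Tuple (Carrier K 𝓀[K] (ULift.{u} ℤ)) l) :=
  {x | Formula.Realize S.interp φ x}

/-- The fiber `{x ∈ K | (x, z) ∈ X_K}` of a definable subset `X` of `VF × Z`. -/
def LocalStructure.fiber {E : Lang.{u}} {K : Type u} [Field K] [ValuativeRel K]
    [TopologicalSpace K] [IsNonarchimedeanLocalField K] (S : LocalStructure E K) {l : List Srt}
    (X : Formula (DPLang E) (.VF :: l)) (z : Tuple (Carrier K 𝓀[K] (ULift.{u} ℤ)) l) : Set K :=
  {x | Tuple.cons (s := .VF) x z ∈ S.points X}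

/-! ## Balls and multiboxes -/

section Multibox

variable (K : Type u) [Field K] [ValuativeRel K] [TopologicalSpace K] [IsNonarchimedeanLocalField K]

theorem interior_integers_nonempty : (interior (𝒪[K] : Set K)).Nonempty := by
  refine ⟨0, mem_interior_iff_mem_nhds.2 ?_⟩
  refine (IsValuativeTopology.mem_nhds_zero_iff _).2 ⟨1, fun x hx => ?_⟩
  have hx' : ValuativeRel.valuation K x < 1 := by simpa using hx
  exact hx'.le

/-- The Haar measure on `K` for which the valuation ring has measure `1`. -/
def haar : @MeasureTheory.Measure K (borel K) :=
  letI : MeasurableSpace K := borel K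
  haveI : BorelSpace K := ⟨rfl⟩
  MeasureTheory.Measure.addHaarMeasure
    ⟨⟨(𝒪[K] : Set K), IsNonarchimedeanLocalField.isCompact_closedBall K 1⟩,
      interior_integers_nonempty K⟩

variable {K}

/-- The volume of a subset of `K`. -/
def vol (Y : Set K) : ℝ≥0∞ :=
  letI : MeasurableSpace K := borel K
  haar K Y

/-- Balls `a + b 𝒪_K` in `K`, with `b ≠ 0`. -/
def IsBall (B : Set K) : Prop :=
  ∃ a b : K, b ≠ 0 ∧ B = {x | ∃ y ∈ 𝒪[K], x = a + b * y}

/-- Multiballs in `𝒪_K` (in dimension one): singletons, of multivolume `0`, and balls. In either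
case the multivolume is the volume. -/
def IsMultiball (Y : Set K) : Prop :=
  Y ⊆ (𝒪[K] : Set K) ∧ ((∃ a, Y = {a}) ∨ IsBall Y)

/-- The multibox of `X`: the union of the multiballs contained in `X` of maximal multivolume among
the multiballs contained in `X`. -/
def multibox (X : Set K) : Set K :=
  ⋃₀ {Y | IsMultiball Y ∧ Y ⊆ X ∧ ∀ Y', IsMultiball Y' → Y' ⊆ X → vol Y' ≤ vol Y}

/-- The balls in `K` that meet `A` and are not contained in `A`. -/
def boundaryBalls (A : Set K) : Set (Set K) :=
  {B | IsBall B ∧ (B ∩ A).Nonempty ∧ ¬ B ⊆ A}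

/-- Those of minimal volume. -/
def minimalBoundaryBalls (A : Set K) : Set (Set K) :=
  {B | B ∈ boundaryBalls A ∧ ∀ B' ∈ boundaryBalls A, vol B ≤ vol B'}

end Multibox

end DPas

end

/-! The heart is a uniform statement about centers (`exists_uniform_hasCenters`): for some `N`, in
every local field of residue characteristic at least `N`, each fiber `X_z` has a set `C` of at most
`N` centers such that every `x` in `X_z` admits some `c` in `C` for which all `y` with `ord (y - c)
= ord (x - c)` and `ac (y - c) = ac (x - c)` lie in `X_z`.

Given this, a ball `B` that meets the multibox without being contained in it must contain a center.
Otherwise take `x` in both and its center `c` outside `B`: by the ultrametric inequality `ord (y -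
c)` and `ac (y - c)` are constant for `y` in `B`, so `B ⊆ X_z`, and maximality of the multiball
through `x` puts `B` inside that multiball (`exists_center_mem_of_boundaryBall`). Two balls of the
same minimal volume sharing a center coincide, so there are at most `|C|` of them.

The uniform statement is a compactness argument. Counterexamples for all `n` have a nonprincipal
ultraproduct, a model of `T` by (∗∗) and Łoś. There b-minimality writes the fiber as cells with
centers `c(s)`, for `s` in `k^r × Γ^t`. If the image of `c` is finite, representatives of these
centers work at almost every index, since being a suitable center is expressed by a formula; this is
a contradiction.

Finiteness of the image is `finite_of_functional`. With one auxiliary variable, composition with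
`ac` or `ord` gives a locally constant function on `K^×`, with finite image by hypothesis. With more
variables, fix all but one, say at `t`: the values form a finite set `D(t)`, coded by the
coefficients of the monic polynomial with simple roots `D(t)`. For each degree these are definable
partial functions of `t`, of finite image by induction. So there are countably many values in all,
hence finitely many by saturation of the ultraproduct (`finite_of_countable_ultra`). -/

namespace DPas

/-! ## Substitution -/

section Subst

variable {L : Lang.{u}}

/-- Substitution of terms for variables. -/
def Term.subst {ctx ctx' : List Srt} (σ : ∀ i : Fin ctx.length, Term L ctx' (ctx.get i)) :
    {s : Srt} → Term L ctx s → Term L ctx' s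
  | _, .var i => σ i
  | _, .app f ts => .app f (fun i => (ts i).subst σ)

/-- The weakening of a term by one new variable. -/
def Term.weaken {ctx : List Srt} (r : Srt) {s : Srt} (t : Term L ctx s) : Term L (r :: ctx) s :=
  t.subst fun i => .var (ctx := r :: ctx) i.succ

/-- The substitution that fixes a new variable. -/
def liftSubst {ctx ctx' : List Srt} (s : Srt)
    (σ : ∀ i : Fin ctx.length, Term L ctx' (ctx.get i)) (i : Fin (s :: ctx).length) :
    Term L (s :: ctx') ((s :: ctx).get i) :=
  Fin.cases (motive := fun i : Fin (ctx.length + 1) => Term L (s :: ctx') ((s :: ctx).get i))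
    (.var (ctx := s :: ctx') (0 : Fin (ctx'.length + 1))) (fun i => (σ i).weaken s) i

/-- Substitution of terms for the free variables of a formula. -/
def Formula.subst : {ctx ctx' : List Srt} →
    (∀ i : Fin ctx.length, Term L ctx' (ctx.get i)) → Formula L ctx → Formula L ctx'
  | _, _, _, .falsum => .falsum
  | _, _, σ, .eq t₁ t₂ => .eq (t₁.subst σ) (t₂.subst σ)
  | _, _, σ, .rel R ts => .rel R (fun i => (ts i).subst σ)
  | _, _, σ, .imp φ ψ => .imp (φ.subst σ) (ψ.subst σ)
  | _, _, σ, .all s φ => .all s (φ.subst (liftSubst s σ))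

variable {K k Γ : Type u} (M : Interp L K k Γ)

theorem Term.eval_subst {ctx ctx' : List Srt} (σ : ∀ i : Fin ctx.length, Term L ctx' (ctx.get i))
    (v : Tuple (Carrier K k Γ) ctx') {s : Srt} (t : Term L ctx s) :
    (t.subst σ).eval M v = t.eval M (fun i => (σ i).eval M v) := by
  induction t with
  | var i => rfl
  | app f ts ih => simp only [Term.subst, Term.eval, ih]

theorem Term.eval_weaken {ctx : List Srt} {r : Srt} (x : Carrier K k Γ r)
    (v : Tuple (Carrier K k Γ) ctx) {s : Srt} (t : Term L ctx s) :
    (t.weaken r).eval M (Tuple.cons x v) = t.eval M v :=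
  t.eval_subst M _ _

theorem eval_liftSubst {ctx ctx' : List Srt} {s : Srt}
    (σ : ∀ i : Fin ctx.length, Term L ctx' (ctx.get i))
    (v : Tuple (Carrier K k Γ) ctx') (x : Carrier K k Γ s) :
    (fun i => (liftSubst s σ i).eval M (Tuple.cons x v)) =
      Tuple.cons x (fun i => (σ i).eval M v) := by
  funext i
  refine Fin.cases (motive := fun i : Fin (ctx.length + 1) =>
    (liftSubst s σ i).eval M (Tuple.cons x v) =
      (Tuple.cons x (fun i => (σ i).eval M v) : Tuple (Carrier K k Γ) (s :: ctx)) i) rfl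
    (fun i => ?_) i
  exact (σ i).eval_weaken M x v

theorem Formula.realize_subst {ctx : List Srt} (φ : Formula L ctx) : ∀ {ctx' : List Srt}
    (σ : ∀ i : Fin ctx.length, Term L ctx' (ctx.get i)) (v : Tuple (Carrier K k Γ) ctx'),
    (φ.subst σ).Realize M v ↔ φ.Realize M (fun i => (σ i).eval M v) := by
  induction φ with
  | falsum => intros; rfl
  | eq t₁ t₂ => intros; simp only [Formula.subst, Formula.Realize, Term.eval_subst]
  | rel R ts => intros; simp only [Formula.subst, Formula.Realize, Term.eval_subst]
  | imp φ ψ h₁ h₂ => intros; simp only [Formula.subst, Formula.Realize, h₁, h₂]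
  | all s φ h => intros; simp only [Formula.subst, Formula.Realize, h, eval_liftSubst]

end Subst

/-! ## A calculus of definable predicates -/

section Definability

variable {L : Lang.{u}} {K k Γ : Type u} (M : Interp L K k Γ)

/-- `P` is defined by a formula in the coordinates given by `e`. -/
def DefVia {α : Type*} {ctx : List Srt} (e : α → Tuple (Carrier K k Γ) ctx) (P : α → Prop) : Prop :=
  ∃ φ : Formula L ctx, ∀ x, P x ↔ φ.Realize M (e x)

/-- `F` is given by a term in the coordinates given by `e`. -/
def TermVia {α : Type*} {ctx : List Srt} (e : α → Tuple (Carrier K k Γ) ctx) {s : Srt}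
    (F : α → Carrier K k Γ s) : Prop :=
  ∃ t : Term L ctx s, ∀ x, t.eval M (e x) = F x

/-- The coordinates given by `e` together with a new one. -/
def extend {α : Type*} {ctx : List Srt} (s : Srt) (e : α → Tuple (Carrier K k Γ) ctx)
    (p : α × Carrier K k Γ s) : Tuple (Carrier K k Γ) (s :: ctx) := Tuple.cons p.2 (e p.1)

/-- The context `ctx` with `n` new variables of the valued field sort. -/
def addVF (ctx : List Srt) : ℕ → List Srt
  | 0 => ctx
  | n + 1 => .VF :: addVF ctx n

/-- The coordinates given by `e` together with `n` new ones in the valued field. -/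
def extendVF {α : Type*} {ctx : List Srt} (e : α → Tuple (Carrier K k Γ) ctx) :
    (n : ℕ) → α × (Fin n → K) → Tuple (Carrier K k Γ) (addVF ctx n)
  | 0, p => e p.1
  | n + 1, p => Tuple.cons (s := .VF) (p.2 0) (extendVF e n (p.1, fun i => p.2 i.succ))

variable {M} {α β : Type*} {ctx ctx' : List Srt} {e : α → Tuple (Carrier K k Γ) ctx}
  {P Q : α → Prop} {s : Srt}

theorem TermVia.var (e : α → Tuple (Carrier K k Γ) ctx) (i : Fin ctx.length) :
    TermVia M e (fun x => e x i) := ⟨.var i, fun _ => rfl⟩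

theorem TermVia.head (e : α → Tuple (Carrier K k Γ) ctx) :
    TermVia M (extend s e) (fun p => p.2) :=
  ⟨.var (ctx := s :: ctx) (0 : Fin (ctx.length + 1)), fun _ => rfl⟩

theorem TermVia.weaken (r : Srt) {F : α → Carrier K k Γ s} (h : TermVia M e F) :
    TermVia M (extend r e) (fun p => F p.1) := by
  obtain ⟨t, ht⟩ := h
  exact ⟨t.weaken r, fun p => (t.eval_weaken M _ _).trans (ht _)⟩

theorem TermVia.weakenVF {F : α → Carrier K k Γ s} (h : TermVia M e F) :
    ∀ n, TermVia M (extendVF e n) (fun p => F p.1)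
  | 0 => by obtain ⟨t, ht⟩ := h; exact ⟨t, fun p => ht _⟩
  | n + 1 => by
    obtain ⟨t, ht⟩ := h.weakenVF n
    exact ⟨t.weaken .VF, fun p => (t.eval_weaken M _ _).trans (ht _)⟩

theorem TermVia.coordVF (e : α → Tuple (Carrier K k Γ) ctx) : ∀ (n : ℕ) (i : Fin n),
    TermVia M (s := .VF) (extendVF e n) (fun p => p.2 i)
  | 0, i => i.elim0
  | n + 1, i => by
    refine Fin.cases ?_ (fun i => ?_) i
    · exact ⟨.var (ctx := .VF :: addVF ctx n) (0 : Fin ((addVF ctx n).length + 1)), fun _ => rfl⟩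
    · obtain ⟨t, ht⟩ := TermVia.coordVF e n i
      exact ⟨t.weaken .VF, fun p => (t.eval_weaken M _ _).trans (ht _)⟩

theorem DefVia.congr (h : DefVia M e P) (hPQ : ∀ x, Q x ↔ P x) : DefVia M e Q := by
  obtain ⟨φ, hφ⟩ := h
  exact ⟨φ, fun x => (hPQ x).trans (hφ x)⟩

theorem DefVia.eq {F G : α → Carrier K k Γ s} (hF : TermVia M e F) (hG : TermVia M e G) :
    DefVia M e (fun x => F x = G x) := by
  obtain ⟨t, ht⟩ := hF
  obtain ⟨t', ht'⟩ := hG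
  exact ⟨.eq t t', fun x => by simp only [Formula.Realize, ht, ht']⟩

theorem DefVia.imp (hP : DefVia M e P) (hQ : DefVia M e Q) : DefVia M e (fun x => P x → Q x) := by
  obtain ⟨φ, hφ⟩ := hP
  obtain ⟨ψ, hψ⟩ := hQ
  exact ⟨.imp φ ψ, fun x => by simp only [Formula.Realize, hφ, hψ]⟩

theorem DefVia.not (hP : DefVia M e P) : DefVia M e (fun x => ¬ P x) :=
  hP.imp (Q := fun _ => False) ⟨.falsum, fun _ => Iff.rfl⟩

theorem DefVia.and (hP : DefVia M e P) (hQ : DefVia M e Q) : DefVia M e (fun x => P x ∧ Q x) :=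
  (hP.imp hQ.not).not.congr fun x => by tauto

theorem DefVia.or (hP : DefVia M e P) (hQ : DefVia M e Q) : DefVia M e (fun x => P x ∨ Q x) :=
  (hP.not.imp hQ).congr fun x => by tauto

theorem DefVia.all (s : Srt) {P : α → Carrier K k Γ s → Prop}
    (h : DefVia M (extend s e) (fun p => P p.1 p.2)) : DefVia M e (fun x => ∀ y, P x y) := by
  obtain ⟨φ, hφ⟩ := h
  exact ⟨.all s φ, fun x => forall_congr' fun y => hφ (x, y)⟩

theorem DefVia.ex (s : Srt) {P : α → Carrier K k Γ s → Prop}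
    (h : DefVia M (extend s e) (fun p => P p.1 p.2)) : DefVia M e (fun x => ∃ y, P x y) :=
  (DefVia.all s (P := fun x y => ¬ P x y) h.not).not.congr fun x => by simp

theorem DefVia.allVF : ∀ (n : ℕ) {P : α → (Fin n → K) → Prop},
    DefVia M (extendVF e n) (fun p => P p.1 p.2) → DefVia M e (fun x => ∀ c, P x c)
  | 0, P, ⟨φ, hφ⟩ => ⟨φ, fun x => ⟨fun h => (hφ (x, Fin.elim0)).1 (h _), fun h c => by
      rw [Subsingleton.elim c Fin.elim0]; exact (hφ (x, Fin.elim0)).2 h⟩⟩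
  | n + 1, P, ⟨φ, hφ⟩ => by
    refine (DefVia.allVF n (P := fun x c => ∀ y : K, P x (Fin.cons y c))
      ⟨.all .VF φ, fun p => forall_congr' fun y => ?_⟩).congr fun x => ?_
    · exact hφ (p.1, Fin.cons y p.2)
    · rw [Fin.forall_fin_succ_pi, forall_comm]

theorem DefVia.exVF (n : ℕ) {P : α → (Fin n → K) → Prop}
    (h : DefVia M (extendVF e n) (fun p => P p.1 p.2)) : DefVia M e (fun x => ∃ c, P x c) :=
  (DefVia.allVF n (P := fun x y => ¬ P x y) h.not).not.congr fun x => by simp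

/-- Closure under substitution of terms: it lets a given relation be read at computed points, such
as the angular component of a variable. -/
theorem DefVia.comp {e' : β → Tuple (Carrier K k Γ) ctx'} {P : β → Prop} (h : DefVia M e' P)
    (g : α → β) (hg : ∀ i, TermVia M e (fun x => e' (g x) i)) : DefVia M e (fun x => P (g x)) := by
  obtain ⟨φ, hφ⟩ := h
  choose t ht using hg
  exact ⟨φ.subst t, fun x => by simp only [Formula.realize_subst, ht, hφ]⟩

theorem TermVia.forall_extend {e' : β → Tuple (Carrier K k Γ) ctx'}
    {g : α → β × Carrier K k Γ s} (h₀ : TermVia M e (fun x => (g x).2))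
    (h : ∀ i, TermVia M e (fun x => e' (g x).1 i)) :
    ∀ i, TermVia M e (fun x => extend s e' (g x) i) := fun i =>
  Fin.cases (motive := fun i : Fin (ctx'.length + 1) =>
    TermVia M e (s := (s :: ctx').get i) (fun x => extend s e' (g x) i)) h₀ h i

end Definability

/-! ## Ultraproducts -/

/-- A three-sorted structure with its carriers. -/
structure Str (L : Lang.{u}) : Type (u + 1) where
  K : Type u
  k : Type u
  Γ : Type u
  interp : Interp L K k Γ

/-- The carriers of a structure. -/
abbrev Str.carrier {L : Lang.{u}} (A : Str L) : Srt → Type u := Carrier A.K A.k A.Γ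

section Ultraproduct

variable {L : Lang.{u}} (U : Ultrafilter ℕ) (A : ℕ → Str L)

/-- The carriers of an ultraproduct. -/
abbrev UltraCarrier : Srt → Type u :=
  Carrier ((U : Filter ℕ).Product fun n => (A n).K) ((U : Filter ℕ).Product fun n => (A n).k)
    ((U : Filter ℕ).Product fun n => (A n).Γ)

variable {A}

/-- The class of a sequence in an ultraproduct. -/
def ultraMk : {s : Srt} → (∀ n, (A n).carrier s) → UltraCarrier U A s
  | .VF, x => Quotient.mk _ x
  | .RF, x => Quotient.mk _ x
  | .VG, x => Quotient.mk _ x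

variable {U}

/-- A representing sequence of an element of an ultraproduct. -/
noncomputable def ultraRep : {s : Srt} → UltraCarrier U A s → ∀ n, (A n).carrier s
  | .VF, x => Quotient.out x
  | .RF, x => Quotient.out x
  | .VG, x => Quotient.out x

theorem ultraMk_rep {s : Srt} (x : UltraCarrier U A s) : ultraMk U (ultraRep x) = x := by
  cases s <;> exact Quotient.out_eq _

theorem ultraMk_eq_iff {s : Srt} (x y : ∀ n, (A n).carrier s) :
    ultraMk U x = ultraMk U y ↔ ∀ᶠ n in (U : Filter ℕ), x n = y n := by
  cases s <;> exact Quotient.eq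

theorem ultraRep_mk {s : Srt} (x : ∀ n, (A n).carrier s) :
    ∀ᶠ n in (U : Filter ℕ), ultraRep (ultraMk U x) n = x n :=
  (ultraMk_eq_iff _ _).1 (ultraMk_rep _)

variable (U)

/-- The class of a sequence of tuples. -/
def ultraTuple {l : List Srt} (v : ∀ n, Tuple (A n).carrier l) : Tuple (UltraCarrier U A) l :=
  fun i => ultraMk U (fun n => v n i)

variable {U} in
theorem ultraTuple_rep {l : List Srt} (v : Tuple (UltraCarrier U A) l) :
    ultraTuple U (fun n i => ultraRep (v i) n) = v :=
  funext fun i => ultraMk_rep (v i)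

theorem ultraTuple_cons {l : List Srt} {s : Srt} (x : ∀ n, (A n).carrier s)
    (v : ∀ n, Tuple (A n).carrier l) :
    ultraTuple U (fun n => Tuple.cons (x n) (v n)) = Tuple.cons (ultraMk U x) (ultraTuple U v) := by
  funext i
  exact Fin.cases (motive := fun i : Fin (l.length + 1) =>
    ultraTuple U (fun n => Tuple.cons (x n) (v n)) i =
      (Tuple.cons (ultraMk U x) (ultraTuple U v) : Tuple (UltraCarrier U A) (s :: l)) i)
    rfl (fun _ => rfl) i

theorem ultraTuple_append : ∀ {l m : List Srt} (v : ∀ n, Tuple (A n).carrier l)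
    (w : ∀ n, Tuple (A n).carrier m),
    ultraTuple U (fun n => (v n).append (w n)) = (ultraTuple U v).append (ultraTuple U w)
  | [], _, _, _ => rfl
  | _ :: _, _, v, w => by
    simp only [Tuple.append]
    rw [ultraTuple_cons, ultraTuple_append]
    rfl

variable (A) in
/-- The ultraproduct of a sequence of structures. -/
noncomputable def ultraInterp : Interp L ((U : Filter ℕ).Product fun n => (A n).K)
    ((U : Filter ℕ).Product fun n => (A n).k) ((U : Filter ℕ).Product fun n => (A n).Γ) where
  fn f v := ultraMk U fun n => (A n).interp.fn f fun i => ultraRep (v i) n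
  rel R v := ∀ᶠ n in (U : Filter ℕ), (A n).interp.rel R fun i => ultraRep (v i) n

/-- `ultraInterp` is defined through chosen representatives. A tuple has finitely many coordinates,
so their almost-everywhere agreements with a given sequence hold simultaneously. -/
theorem eventually_rep_eq {l : List Srt} (v : ∀ n, Tuple (A n).carrier l) :
    ∀ᶠ n in (U : Filter ℕ), (fun i => ultraRep (ultraTuple U v i) n) = v n := by
  simp only [funext_iff]
  exact Filter.eventually_all.2 fun i => ultraRep_mk _

theorem eval_ultraTuple {ctx : List Srt} (v : ∀ n, Tuple (A n).carrier ctx) {s : Srt}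
    (t : Term L ctx s) : t.eval (ultraInterp U A) (ultraTuple U v) =
      ultraMk U (fun n => t.eval (A n).interp (v n)) := by
  induction t with
  | var i => rfl
  | app f ts ih =>
    simp only [Term.eval, ih]
    refine (ultraMk_eq_iff _ _).2 ?_
    filter_upwards [eventually_rep_eq U fun n i => (ts i).eval (A n).interp (v n)] with n hn
    exact congrArg _ hn

/-- The theorem of Łoś. -/
theorem realize_ultraTuple [∀ n s, Nonempty ((A n).carrier s)] {ctx : List Srt}
    (φ : Formula L ctx) : ∀ v : ∀ n, Tuple (A n).carrier ctx,
    φ.Realize (ultraInterp U A) (ultraTuple U v) ↔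
      ∀ᶠ n in (U : Filter ℕ), φ.Realize (A n).interp (v n) := by
  induction φ with
  | falsum => intro v; simpa [Formula.Realize] using U.neBot.ne
  | eq t₁ t₂ => intro v; simp only [Formula.Realize, eval_ultraTuple, ultraMk_eq_iff]
  | rel R ts =>
    intro v
    simp only [Formula.Realize, eval_ultraTuple]
    refine Filter.eventually_congr ?_
    filter_upwards [eventually_rep_eq U fun n i => (ts i).eval (A n).interp (v n)] with n hn
    exact iff_of_eq (congrArg _ hn)
  | imp φ ψ h₁ h₂ =>
    intro v
    simp only [Formula.Realize, h₁, h₂]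
    exact Ultrafilter.eventually_imp.symm
  | all s φ ih =>
    intro v
    simp only [Formula.Realize]
    constructor
    · intro h
      by_contra hne
      rw [← Ultrafilter.eventually_not] at hne
      -- A counterexample is chosen at each index where one exists; its class then refutes `h`.
      have : ∀ n, ∃ x : (A n).carrier s, (¬ ∀ x, φ.Realize (A n).interp (Tuple.cons x (v n))) →
          ¬ φ.Realize (A n).interp (Tuple.cons x (v n)) := by
        intro n
        by_cases hn : ∀ x, φ.Realize (A n).interp (Tuple.cons x (v n))
        · exact ⟨Classical.arbitrary _, fun h => absurd hn h⟩
        · obtain ⟨x, hx⟩ := not_forall.1 hn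
          exact ⟨x, fun _ => hx⟩
      choose x hx using this
      have h1 := h (ultraMk U x)
      rw [← ultraTuple_cons, ih] at h1
      obtain ⟨n, h2, h3⟩ := (h1.and hne).exists
      exact hx n h3 h2
    · intro h x
      rw [← ultraMk_rep x, ← ultraTuple_cons, ih]
      exact h.mono fun n hn => hn _

/-- A countable projection of a definable set in a nonprincipal ultraproduct is finite. -/
theorem finite_of_countable_ultra [∀ n s, Nonempty ((A n).carrier s)]
    (hU : (U : Filter ℕ) ≤ Filter.atTop) {s : Srt} {l m : List Srt}
    (a : Tuple (UltraCarrier U A) m) (φ : Formula L (s :: (l ++ m)))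
    (hD : {y : UltraCarrier U A s | ∃ t : Tuple (UltraCarrier U A) l,
      φ.Realize (ultraInterp U A) (Tuple.cons y (t.append a))}.Countable) :
    {y : UltraCarrier U A s | ∃ t : Tuple (UltraCarrier U A) l,
      φ.Realize (ultraInterp U A) (Tuple.cons y (t.append a))}.Finite := by
  set D := {y : UltraCarrier U A s | ∃ t : Tuple (UltraCarrier U A) l,
      φ.Realize (ultraInterp U A) (Tuple.cons y (t.append a))} with hDdef
  let D' (n : ℕ) : Set ((A n).carrier s) := {y | ∃ t : Tuple (A n).carrier l,
      φ.Realize (A n).interp (Tuple.cons y (t.append fun i => ultraRep (a i) n))}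
  -- `D` is internal: membership is decided coordinatewise by the sets `D' n`.
  have key : ∀ x : ∀ n, (A n).carrier s,
      ultraMk U x ∈ D ↔ ∀ᶠ n in (U : Filter ℕ), x n ∈ D' n := by
    intro x
    constructor
    · rintro ⟨t, ht⟩
      rw [← ultraTuple_rep t, ← ultraTuple_rep a, ← ultraTuple_append, ← ultraTuple_cons,
        realize_ultraTuple] at ht
      exact ht.mono fun n hn => ⟨_, hn⟩
    · intro h
      have : ∀ n, ∃ t : Tuple (A n).carrier l, x n ∈ D' n →
          φ.Realize (A n).interp (Tuple.cons (x n) (t.append fun i => ultraRep (a i) n)) := by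
        intro n
        by_cases hn : x n ∈ D' n
        · obtain ⟨t, ht⟩ := hn
          exact ⟨t, fun _ => ht⟩
        · exact ⟨fun i => Classical.arbitrary _, fun h => absurd h hn⟩
      choose t ht using this
      refine ⟨ultraTuple U t, ?_⟩
      rw [← ultraTuple_rep a, ← ultraTuple_append, ← ultraTuple_cons, realize_ultraTuple]
      exact h.mono ht
  by_contra hinf
  have hinf : D.Infinite := hinf
  obtain ⟨d, hd⟩ := hD.exists_eq_range hinf.nonempty
  -- Diagonalization against the enumeration `d`: `P n m` says that `D' n` has a point off the
  -- `n`-th coordinates of the first `m` terms. As `D` is infinite, this holds for almost all `n`,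
  -- for each fixed `m`.
  let P (n m : ℕ) : Prop := ∃ y ∈ D' n, ∀ i < m, y ≠ ultraRep (d i) n
  have hP : ∀ m, ∀ᶠ n in (U : Filter ℕ), P n m := by
    intro m
    obtain ⟨y, hy, hym⟩ := hinf.exists_notMem_finite ((Set.finite_Iio m).image d)
    rw [← ultraMk_rep y, key] at hy
    have h2 : ∀ᶠ n in (U : Filter ℕ), ∀ i ∈ Set.Iio m, ultraRep y n ≠ ultraRep (d i) n := by
      refine (Filter.eventually_all_finite (Set.finite_Iio m)).2 fun i hi => ?_
      rw [Ultrafilter.eventually_not, ← ultraMk_eq_iff, ultraMk_rep, ultraMk_rep]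
      exact fun h => hym ⟨i, hi, h.symm⟩
    filter_upwards [hy, h2] with n h3 h4
    exact ⟨_, h3, fun i hi => h4 i hi⟩
  classical
  -- At index `n`, as many as possible of the first `n` terms are avoided. Since the ultrafilter is
  -- nonprincipal, the cap `n` exceeds any fixed `i` almost everywhere, so the resulting class
  -- differs from every `d i`.
  have : ∀ n, ∃ y : (A n).carrier s, P n 0 →
      y ∈ D' n ∧ ∀ i < Nat.findGreatest (P n) n, y ≠ ultraRep (d i) n := by
    intro n
    by_cases hn : P n 0
    · obtain ⟨y, hy⟩ := Nat.findGreatest_spec (Nat.zero_le n) hn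
      exact ⟨y, fun _ => hy⟩
    · exact ⟨Classical.arbitrary _, fun h => absurd h hn⟩
  choose x hx using this
  have hxD : ultraMk U x ∈ D := (key x).2 ((hP 0).mono fun n hn => (hx n hn).1)
  rw [hd] at hxD
  obtain ⟨i, hi⟩ := hxD
  rw [← ultraMk_rep (d i), ultraMk_eq_iff] at hi
  obtain ⟨n, h1, h2, h3, h4⟩ := (hi.and ((hP 0).and ((hP (i + 1)).and
    (hU (Filter.eventually_ge_atTop (i + 1)))))).exists
  exact (hx n h2).2 i (Nat.le_findGreatest h4 h3) h1.symm

end Ultraproduct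

/-! ## Definability in valued fields with angular component -/

section Terms

variable {K k Γ : Type u} [Field K] [Field k] [AddCommGroup Γ] [LinearOrder Γ]
  [IsOrderedAddMonoid Γ] {E : Lang.{u}} {V : AcValued K k Γ} {M : Interp (DPLang E) K k Γ}
  {α : Type*} {ctx : List Srt} {e : α → Tuple (Carrier K k Γ) ctx}

theorem TermVia.zero (hM : M.Expands V) : TermVia M (s := .VF) e (fun _ => (0 : K)) :=
  ⟨.app (Sum.inl DPFn.zeroK) Tuple.nil, fun _ => hM.1 _ _ _ _⟩

theorem TermVia.one (hM : M.Expands V) : TermVia M (s := .VF) e (fun _ => (1 : K)) :=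
  ⟨.app (Sum.inl DPFn.oneK) Tuple.nil, fun _ => hM.1 _ _ _ _⟩

variable {F G : α → K}

theorem TermVia.add (hM : M.Expands V) (hF : TermVia M (s := .VF) e F)
    (hG : TermVia M (s := .VF) e G) : TermVia M (s := .VF) e (fun x => F x + G x) := by
  obtain ⟨t, ht⟩ := hF
  obtain ⟨t', ht'⟩ := hG
  -- `Term L ctx` is itself a family of types indexed by sorts, so `Tuple.cons` also builds argument
  -- lists of terms.
  refine ⟨.app (a := [.VF, .VF]) (Sum.inl DPFn.addK) (Tuple.cons t (Tuple.cons t' Tuple.nil)),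
    fun x => (hM.1 _ _ _ _).trans ?_⟩
  exact congrArg₂ (· + · : K → K → K) (ht x) (ht' x)

theorem TermVia.mul (hM : M.Expands V) (hF : TermVia M (s := .VF) e F)
    (hG : TermVia M (s := .VF) e G) : TermVia M (s := .VF) e (fun x => F x * G x) := by
  obtain ⟨t, ht⟩ := hF
  obtain ⟨t', ht'⟩ := hG
  refine ⟨.app (a := [.VF, .VF]) (Sum.inl DPFn.mulK) (Tuple.cons t (Tuple.cons t' Tuple.nil)),
    fun x => (hM.1 _ _ _ _).trans ?_⟩
  exact congrArg₂ (· * · : K → K → K) (ht x) (ht' x)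

theorem TermVia.pow (hM : M.Expands V) (hF : TermVia M (s := .VF) e F) :
    ∀ n : ℕ, TermVia M (s := .VF) e (fun x => F x ^ n)
  | 0 => by simpa using TermVia.one hM
  | n + 1 => by simpa only [pow_succ] using (TermVia.pow hM hF n).mul hM hF

theorem TermVia.sum (hM : M.Expands V) {n : ℕ} {F : Fin n → α → K}
    (hF : ∀ i, TermVia M (s := .VF) e (F i)) :
    TermVia M (s := .VF) e (fun x => (∑ i, F i x : K)) := by
  have h := Finset.sum_induction (M := α → K) (s := Finset.univ) F (fun F => TermVia M (s := .VF) e F)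
    (fun _ _ => TermVia.add hM) (TermVia.zero hM) (fun i _ => hF i)
  have h' : (∑ i, F i) = fun x => (∑ i, F i x : K) := funext fun x => Finset.sum_apply _ _ _
  exact h' ▸ h

theorem TermVia.ac (hM : M.Expands V) (hF : TermVia M (s := .VF) e F) :
    TermVia M (s := .RF) e (fun x => V.ac (F x)) := by
  obtain ⟨t, ht⟩ := hF
  refine ⟨.app (a := [.VF]) (Sum.inl DPFn.ac) (Tuple.cons t Tuple.nil),
    fun x => (hM.1 _ _ _ _).trans ?_⟩
  exact congrArg V.ac (ht x)

theorem TermVia.ord (hM : M.Expands V) (hF : TermVia M (s := .VF) e F) :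
    TermVia M (s := .VG) e (fun x => WithTop.untopD (0 : Γ) (V.v (F x))) := by
  obtain ⟨t, ht⟩ := hF
  refine ⟨.app (a := [.VF]) (Sum.inl DPFn.ord) (Tuple.cons t Tuple.nil),
    fun x => (hM.1 _ _ _ _).trans ?_⟩
  exact congrArg (fun y : K => WithTop.untopD (0 : Γ) (V.v y)) (ht x)

end Terms

/-! ### Residues, and local constancy of `ord` and `ac` -/

section AcValued

variable {K k Γ : Type u} [Field K] [Field k] [AddCommGroup Γ] [LinearOrder Γ]
  [IsOrderedAddMonoid Γ] (V : AcValued K k Γ)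

theorem AcValued.exists_inv_one_sub (x : V.integers) (hx : 0 < V.v (x : K)) :
    ∃ w : V.integers, (1 - x) * w = 1 := by
  have h1 : V.v (1 - (x : K)) = 0 := by
    have h := AddValuation.map_sub_eq_of_lt_right V.v (x := (x : K)) (y := 1) (by simpa using hx)
    rw [AddValuation.map_sub_swap, h, AddValuation.map_one]
  have h0 : (1 - (x : K)) ≠ 0 := by
    intro h0
    rw [h0, AddValuation.map_zero] at h1
    exact WithTop.top_ne_zero h1
  have h2 : 0 ≤ V.v (1 - (x : K))⁻¹ := by
    have h3 := V.v.map_mul (1 - (x : K)) (1 - (x : K))⁻¹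
    rw [mul_inv_cancel₀ h0, h1, zero_add, V.v.map_one] at h3
    exact h3.le
  exact ⟨⟨_, (V.mem_integers _).2 h2⟩, Subtype.ext (mul_inv_cancel₀ h0)⟩

/-- The structure only asks that `res` be a surjection onto a field. If `res x ≠ 0`, choose `y` with
`res y` its inverse: then `1 - x * y` is a unit with residue `0`, which is absurd. -/
theorem AcValued.res_eq_zero {x : V.integers} (hx : 0 < V.v (x : K)) : V.res x = 0 := by
  by_contra h
  obtain ⟨y, hy⟩ := V.res_surjective (V.res x)⁻¹
  have hxy : 0 < V.v ((x * y : V.integers) : K) := by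
    have h1 : V.v ((x * y : V.integers) : K) = V.v (x : K) + V.v (y : K) := V.v.map_mul _ _
    rw [h1]
    exact add_pos_of_pos_of_nonneg hx ((V.mem_integers _).1 y.2)
  obtain ⟨w, hw⟩ := V.exists_inv_one_sub _ hxy
  have h4 := congrArg V.res hw
  rw [map_mul, map_sub, map_mul, hy, mul_inv_cancel₀ h, map_one, sub_self, zero_mul] at h4
  exact zero_ne_one h4

theorem AcValued.ac_surjective : Function.Surjective V.ac := by
  intro ξ
  by_cases hξ : ξ = 0
  · exact ⟨0, by rw [hξ, map_zero]⟩
  obtain ⟨x, rfl⟩ := V.res_surjective ξ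
  refine ⟨x, V.ac_eq_res x (le_antisymm ?_ x.2)⟩
  by_contra h
  exact hξ (V.res_eq_zero (not_le.1 h))

theorem AcValued.ord_surjective :
    Function.Surjective fun x : K => WithTop.untopD (0 : Γ) (V.v x) := by
  intro γ
  obtain ⟨x, hx⟩ := V.exists_v_eq γ
  exact ⟨x, by simp [hx]⟩

theorem AcValued.v_eq_of_lt {x y : K} (h : V.v x < V.v (y - x)) : V.v y = V.v x := by
  have := AddValuation.map_add_eq_of_lt_right V.v h
  rwa [sub_add_cancel] at this

theorem AcValued.ac_eq_one {x : K} (h : 0 < V.v (x - 1)) : V.ac x = 1 := by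
  have hx : V.v x = 0 := by
    have := V.v_eq_of_lt (x := 1) (y := x) (by rwa [AddValuation.map_one])
    rwa [AddValuation.map_one] at this
  let w : V.integers := ⟨x, (V.mem_integers _).2 hx.ge⟩
  have h1 : V.res (w - 1) = 0 := V.res_eq_zero h
  rw [map_sub, map_one, sub_eq_zero] at h1
  exact (V.ac_eq_res w hx).trans h1

/-- The quotient `y / x` is congruent to `1` modulo the maximal ideal, and `ac` is multiplicative.
Together with `v_eq_of_lt` this makes `ac` and `ord` locally constant away from `0`. -/
theorem AcValued.ac_eq_of_lt {x y : K} (h : V.v x < V.v (y - x)) : V.ac y = V.ac x := by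
  have hx : x ≠ 0 := by
    rintro rfl
    simp at h
  have hq : 0 < V.v (y / x - 1) := by
    by_contra hle
    have h1 : (y - x) = (y / x - 1) * x := by field_simp
    rw [h1, AddValuation.map_mul] at h
    have h2 : V.v (y / x - 1) + V.v x ≤ 0 + V.v x := add_le_add_left (not_lt.1 hle) _
    rw [zero_add] at h2
    exact absurd h (not_lt.2 h2)
  have h1 := V.ac_eq_one hq
  rwa [map_div₀, div_eq_one_iff_eq ((map_ne_zero V.ac).2 hx)] at h1

end AcValued

/-! ## Finiteness of definable families of points -/

section Finiteness

variable {K k Γ : Type u} [Field K] [Field k] [AddCommGroup Γ] [LinearOrder Γ]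
  [IsOrderedAddMonoid Γ] {E : Lang.{u}} {V : AcValued K k Γ} {M : Interp (DPLang E) K k Γ}

/-- Locally constant definable functions on `K \ {0}` have finite image. -/
def LocConstFinite (V : AcValued K k Γ) (M : Interp (DPLang E) K k Γ) : Prop :=
  ∀ g : K → K, M.Definable (graphVF k Γ {x | x ≠ 0} g) →
    (∀ x : K, x ≠ 0 → ∃ γ : Γ, ∀ y : K, y ≠ 0 → (γ : WithTop Γ) < V.v (y - x) → g y = g x) →
    (g '' {x | x ≠ 0}).Finite

/-- Composing the partial function `ξ ↦ y` with `ρ` yields a locally constant function on `K^×`,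
with the same values except possibly at `0`. The map `ρ` is abstract in order to cover both `ac` and
`ord`. -/
theorem finite_of_functional_comp (hM : M.Expands V) (hloc : LocConstFinite V M) {s : Srt}
    {ctx : List Srt} (b : Tuple (Carrier K k Γ) ctx) (φ : Formula (DPLang E) (.VF :: s :: ctx))
    (hφ : ∀ (ξ : Carrier K k Γ s) (y y' : K), φ.Realize M (Tuple.cons (s := .VF) y (Tuple.cons ξ b)) →
      φ.Realize M (Tuple.cons (s := .VF) y' (Tuple.cons ξ b)) → y = y')
    (ρ : K → Carrier K k Γ s) (hρ : Function.Surjective ρ)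
    (hρ' : ∀ x y, V.v x < V.v (y - x) → ρ y = ρ x)
    (hdef : ∀ {α : Type u} {ctx : List Srt} {e : α → Tuple (Carrier K k Γ) ctx} {F : α → K},
      TermVia M (s := .VF) e F → TermVia M e (fun x => ρ (F x))) :
    {y : K | ∃ ξ, φ.Realize M (Tuple.cons (s := .VF) y (Tuple.cons ξ b))}.Finite := by
  classical
  let R (y : K) (ξ : Carrier K k Γ s) : Prop :=
    φ.Realize M (Tuple.cons (s := .VF) y (Tuple.cons ξ b))
  let g (x : K) : K := if h : ∃ y, R y (ρ x) then h.choose else 0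
  have hg : ∀ x y, g x = y ↔ R y (ρ x) ∨ (¬ ∃ y', R y' (ρ x)) ∧ y = 0 := by
    intro x y
    by_cases h : ∃ y, R y (ρ x)
    · simp only [g, dif_pos h, h, not_true_eq_false, false_and, or_false]
      exact ⟨fun h' => h' ▸ h.choose_spec, fun h' => hφ _ _ _ h.choose_spec h'⟩
    · simp only [g, dif_neg h, h, not_false_eq_true, true_and]
      exact ⟨fun h' => Or.inr h'.symm, fun h' => h'.elim (fun h1 => absurd ⟨y, h1⟩ h) Eq.symm⟩
  -- The parameters `b` become the coordinates of a constant map on a one-point type.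
  let e₀ : PUnit.{u + 1} → Tuple (Carrier K k Γ) ctx := fun _ => b
  let e := extend .VF (extend .VF e₀)
  have hR : ∀ {α : Type u} {ctx' : List Srt} (e' : α → Tuple (Carrier K k Γ) ctx') (F G : α → K),
      TermVia M (s := .VF) e' F → TermVia M (s := .VF) e' G →
      (∀ i, TermVia M e' (fun _ => b i)) → DefVia M e' (fun x => R (F x) (ρ (G x))) := by
    intro α ctx' e' F G hF hG hb
    have h : DefVia M (extend .VF (extend s e₀)) (fun p => R p.2 p.1.2) := ⟨φ, fun _ => Iff.rfl⟩
    exact h.comp (fun x => ((PUnit.unit, ρ (G x)), F x))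
      (TermVia.forall_extend hF (TermVia.forall_extend (hdef hG) hb))
  have hb : ∀ i, TermVia M e (fun _ => b i) := fun i =>
    ((TermVia.var e₀ i).weaken .VF).weaken .VF
  have hx : TermVia M (s := .VF) e (fun p => p.2) := TermVia.head _
  have hy : TermVia M (s := .VF) e (fun p => p.1.2) := (TermVia.head _).weaken .VF
  have hgdef : DefVia M e (fun p => p.2 ≠ (0 : K) ∧ g p.2 = p.1.2) := by
    refine (DefVia.eq hx (TermVia.zero hM)).not.and (DefVia.congr (DefVia.or (hR e _ _ hy hx hb)
      (DefVia.and (DefVia.not (DefVia.ex .VF (P := fun p y' => R y' (ρ p.2)) ?_))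
        (DefVia.eq hy (TermVia.zero hM)))) fun p => hg _ _)
    exact hR _ _ _ (TermVia.head _) (hx.weaken .VF) fun i => (hb i).weaken .VF
  have hfin := hloc g ?_ ?_
  -- The value at `x = 0` is added by hand: for `ac`, the point `ξ = 0` is reached only from there.
  · refine (hfin.union (Set.finite_singleton (g 0))).subset ?_
    rintro y ⟨ξ, hξ⟩
    obtain ⟨x, rfl⟩ := hρ ξ
    have hgx : g x = y := (hg x y).2 (Or.inl hξ)
    by_cases hx : x = 0
    · exact Or.inr (by rw [← hgx, hx]; rfl)
    · exact Or.inl ⟨x, hx, hgx⟩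
  · obtain ⟨ψ, hψ⟩ := hgdef
    refine ⟨ctx, b, ψ, fun p => ?_⟩
    have hp : p = Tuple.cons (s := .VF) (p (0 : Fin 2)) (single k Γ (p (1 : Fin 2) : K)) := by
      funext i
      change Fin 2 at i
      fin_cases i <;> rfl
    refine Iff.trans ?_ (hψ ((PUnit.unit, p (1 : Fin 2)), p (0 : Fin 2)))
    constructor
    · rintro ⟨x, hx, rfl⟩
      exact ⟨hx, rfl⟩
    · rintro ⟨hx, hy⟩
      exact ⟨p (0 : Fin 2), hx, hp.trans
        (congrArg (fun y : K => Tuple.cons (s := .VF) (p (0 : Fin 2)) (single k Γ y)) hy.symm)⟩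
  · intro x hx
    -- The radius is `ord x` itself: any `y` closer to `x` than `0` is has the same image under `ρ`.
    obtain ⟨γ, hγ⟩ := WithTop.ne_top_iff_exists.1 (mt (AddValuation.top_iff V.v).1 hx)
    refine ⟨γ, fun y _ hy => ?_⟩
    rw [hγ] at hy
    have := hρ' x y hy
    simp only [g, this]

theorem finite_of_functional_slice (hM : M.Expands V) (hloc : LocConstFinite V M) {s : Srt}
    (hs : s ≠ .VF) {ctx : List Srt} (b : Tuple (Carrier K k Γ) ctx)
    (φ : Formula (DPLang E) (.VF :: s :: ctx))
    (hφ : ∀ (ξ : Carrier K k Γ s) (y y' : K), φ.Realize M (Tuple.cons (s := .VF) y (Tuple.cons ξ b)) →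
      φ.Realize M (Tuple.cons (s := .VF) y' (Tuple.cons ξ b)) → y = y') :
    {y : K | ∃ ξ, φ.Realize M (Tuple.cons (s := .VF) y (Tuple.cons ξ b))}.Finite := by
  cases s with
  | VF => exact absurd rfl hs
  | RF =>
    exact finite_of_functional_comp hM hloc b φ hφ V.ac V.ac_surjective
      (fun _ _ h => V.ac_eq_of_lt h) (fun h => h.ac hM)
  | VG =>
    exact finite_of_functional_comp hM hloc b φ hφ (fun x => WithTop.untopD (0 : Γ) (V.v x))
      V.ord_surjective (fun _ _ h => by rw [V.v_eq_of_lt h]) (fun h => h.ord hM)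

/-- The vanishing on `D` of the monic polynomial of degree `n` with lower coefficients `c`. -/
def MonicVanishing (D : Set K) {n : ℕ} (c : Fin n → K) : Prop :=
  ∀ d ∈ D, d ^ n + ∑ i, c i * d ^ (i : ℕ) = 0

/-- Take the product of the `X - d`, of degree `n = |D|`. Another monic polynomial of degree `n`
vanishing on `D` differs from it by one of degree less than `n` with `n` roots, hence zero. An
unordered finite set is thus coded definably by a tuple. -/
theorem exists_unique_monicVanishing {D : Set K} (hD : D.Finite) :
    ∃ n : ℕ, ∃ c : Fin n → K, MonicVanishing D c ∧ ∀ c', MonicVanishing D c' → c' = c := by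
  classical
  let p : Polynomial K := ∏ d ∈ hD.toFinset, (Polynomial.X - Polynomial.C d)
  have hp : p.Monic := Polynomial.monic_prod_of_monic _ _ fun d _ => Polynomial.monic_X_sub_C d
  let n := hD.toFinset.card
  have hn : p.natDegree = n := by
    simp [p, n, Polynomial.natDegree_prod_of_monic, Polynomial.monic_X_sub_C]
  have hpv : MonicVanishing D (fun i : Fin n => p.coeff i) := by
    intro d hd
    have h0 : p.eval d = 0 := by
      rw [Polynomial.eval_prod]
      exact Finset.prod_eq_zero (hD.mem_toFinset.2 hd) (by simp)
    rw [hp.as_sum, hn] at h0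
    simpa [Polynomial.eval_finsetSum, Finset.sum_range] using h0
  refine ⟨n, _, hpv, fun c' hc' => ?_⟩
  let q : Polynomial K := ∑ i : Fin n, Polynomial.C (c' i - p.coeff i) * Polynomial.X ^ (i : ℕ)
  have hq : q = 0 := by
    refine Polynomial.eq_zero_of_degree_lt_of_eval_finset_eq_zero hD.toFinset
      ((Polynomial.degree_sum_fin_lt _).trans_eq rfl) fun d hd => ?_
    have h1 := hc' d (hD.mem_toFinset.1 hd)
    have h2 := hpv d (hD.mem_toFinset.1 hd)
    simp only [q, Polynomial.eval_finsetSum, Polynomial.eval_mul, Polynomial.eval_C,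
      Polynomial.eval_pow, Polynomial.eval_X, sub_mul, Finset.sum_sub_distrib]
    linear_combination h1 - h2
  funext j
  have h3 := congrArg (fun q => Polynomial.coeff q (j : ℕ)) hq
  simp only [q, Polynomial.finsetSum_coeff, Polynomial.coeff_C_mul_X_pow, Polynomial.coeff_zero,
    Fin.val_inj] at h3
  simpa [sub_eq_zero] using h3

theorem finite_monic_roots {n : ℕ} (c : Fin n → K) :
    {d : K | d ^ n + ∑ i, c i * d ^ (i : ℕ) = 0}.Finite := by
  let q : Polynomial K := Polynomial.X ^ n + ∑ i : Fin n, Polynomial.C (c i) * Polynomial.X ^ (i : ℕ)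
  have hq : q.Monic := Polynomial.monic_X_pow_add (Polynomial.degree_sum_fin_lt _)
  refine (Polynomial.finite_setOfPred_isRoot hq.ne_zero).subset fun d hd => ?_
  have hd' : d ^ n + ∑ i, c i * d ^ (i : ℕ) = 0 := hd
  simpa [q, Polynomial.IsRoot, Polynomial.eval_finsetSum] using hd'

/-- If locally constant definable functions have finite image, and countable projections of
definable sets are finite, then definable partial functions from a product of copies of the residue
field and of the value group to the valued field have finite image. -/
theorem finite_of_functional (hM : M.Expands V) (hloc : LocConstFinite V M)
    (hsat : ∀ (l m : List Srt) (a : Tuple (Carrier K k Γ) m)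
      (φ : Formula (DPLang E) (.VF :: (l ++ m))),
      {y : K | ∃ t : Tuple (Carrier K k Γ) l,
        φ.Realize M (Tuple.cons (s := .VF) y (t.append a))}.Countable →
      {y : K | ∃ t : Tuple (Carrier K k Γ) l,
        φ.Realize M (Tuple.cons (s := .VF) y (t.append a))}.Finite) :
    ∀ (l : List Srt), (∀ s ∈ l, s ≠ .VF) → ∀ (m : List Srt) (a : Tuple (Carrier K k Γ) m)
      (φ : Formula (DPLang E) (.VF :: (l ++ m))),
      (∀ (t : Tuple (Carrier K k Γ) l) (y y' : K),
        φ.Realize M (Tuple.cons (s := .VF) y (t.append a)) →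
        φ.Realize M (Tuple.cons (s := .VF) y' (t.append a)) → y = y') →
      {y : K | ∃ t : Tuple (Carrier K k Γ) l,
        φ.Realize M (Tuple.cons (s := .VF) y (t.append a))}.Finite := by
  intro l
  induction l with
  | nil =>
    intro _ m a φ hφ
    refine Set.Subsingleton.finite ?_
    rintro y ⟨t, ht⟩ y' ⟨t', ht'⟩
    exact hφ t y y' ht ht'
  | cons s l ih =>
    intro hl m a φ hφ
    -- It now suffices to show that the image is countable.
    refine hsat _ _ _ _ ?_
    let R (d : K) (ξ : Carrier K k Γ s) (t : Tuple (Carrier K k Γ) l) : Prop :=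
      φ.Realize M (Tuple.cons (s := .VF) d (Tuple.cons ξ (t.append a)))
    let D (t : Tuple (Carrier K k Γ) l) : Set K := {d | ∃ ξ, R d ξ t}
    -- With `t` moved among the parameters, `ξ` is the only variable left.
    have hDfin : ∀ t, (D t).Finite := fun t =>
      finite_of_functional_slice hM hloc (hl s List.mem_cons_self) (t.append a) φ
        fun ξ y y' h h' => hφ (Tuple.cons ξ t) y y' h h'
    -- `y` is the common `j`-th coefficient of all monic polynomials of degree `n` vanishing on `D
    -- t`, at least one existing. This is functional in `t` for every `n`, and defined for all `j`
    -- when `n = |D t|`, so the cardinality of `D t` need not be expressed.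
    let G (n : ℕ) (j : Fin n) (y : K) (t : Tuple (Carrier K k Γ) l) : Prop :=
      (∃ c : Fin n → K, MonicVanishing (D t) c ∧ c j = y) ∧
        ∀ c : Fin n → K, MonicVanishing (D t) c → c j = y
    let e₀ (t : Tuple (Carrier K k Γ) l) : Tuple (Carrier K k Γ) (l ++ m) := t.append a
    have hvan : ∀ n, DefVia M (extendVF (extend .VF e₀) n)
        (fun q => MonicVanishing (D q.1.1) q.2) := by
      intro n
      have hR : DefVia M (extend .VF (extend s e₀)) (fun p => R p.2 p.1.2 p.1.1) :=
        ⟨φ, fun _ => Iff.rfl⟩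
      refine DefVia.congr (P := fun q => ∀ (d : K) (ξ : Carrier K k Γ s), R d ξ q.1.1 →
        d ^ n + ∑ i : Fin n, q.2 i * d ^ (i : ℕ) = 0) ?_ fun q => ?_
      · refine DefVia.all .VF (DefVia.all s (DefVia.imp ?_ (DefVia.eq (s := .VF) ?_
          (TermVia.zero hM))))
        · refine hR.comp (fun x : (((Tuple (Carrier K k Γ) l × K) × (Fin n → K)) × K) ×
            Carrier K k Γ s => ((x.1.1.1.1, x.2), (x.1.2 : K))) (TermVia.forall_extend
            ((TermVia.head _).weaken s) (TermVia.forall_extend (TermVia.head _) fun i => ?_))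
          exact ((((TermVia.var e₀ i).weaken .VF).weakenVF n).weaken .VF).weaken s
        · have hd : TermVia M (s := .VF) (extend s (extend .VF (extendVF (extend .VF e₀) n)))
              (fun x => x.1.2) := (TermVia.head _).weaken s
          exact (hd.pow hM n).add hM (TermVia.sum hM fun i => TermVia.mul hM
            (((TermVia.coordVF _ n i).weaken .VF).weaken s) (hd.pow hM i))
      · exact ⟨fun h d ξ hd => h d ⟨ξ, hd⟩, fun h d ⟨ξ, hd⟩ => h d ξ hd⟩
    have hGdef : ∀ n j, DefVia M (extend .VF e₀) (fun p => G n j p.2 p.1) := by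
      intro n j
      have hc : DefVia M (extendVF (extend .VF e₀) n) (fun q => q.2 j = q.1.2) :=
        DefVia.eq (s := .VF) (TermVia.coordVF _ n j) ((TermVia.head e₀).weakenVF n)
      exact (DefVia.exVF n ((hvan n).and hc)).and (DefVia.allVF n ((hvan n).imp hc))
    have hGfin : ∀ n j, {y : K | ∃ t, G n j y t}.Finite := by
      intro n j
      obtain ⟨ψ, hψ⟩ := hGdef n j
      have h1 : ∀ t y, ψ.Realize M (Tuple.cons (s := .VF) y (t.append a)) ↔ G n j y t :=
        fun t y => (hψ (t, y)).symm
      refine (ih (fun s hs => hl s (List.mem_cons_of_mem _ hs)) m a ψ fun t y y' hy hy' => ?_).subset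
        fun y ⟨t, ht⟩ => ⟨t, (h1 t y).2 ht⟩
      obtain ⟨⟨c, hc, rfl⟩, -⟩ := (h1 t y).1 hy
      exact ((h1 t y').1 hy').2 c hc
    -- For each degree there are finitely many coefficient tuples, each with finitely many roots;
    -- only the union over degrees is infinite.
    refine Set.Countable.mono (s₂ := ⋃ n : ℕ, ⋃ c ∈ Set.univ.pi fun j => {y : K | ∃ t, G n j y t},
      {d : K | d ^ n + ∑ i, c i * d ^ (i : ℕ) = 0}) ?_ ?_
    · rintro d ⟨t', ht'⟩
      let t : Tuple (Carrier K k Γ) l := fun i => t' i.succ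
      have hd : d ∈ D t := ⟨t' ⟨0, Nat.succ_pos _⟩, ht'⟩
      obtain ⟨n, c, hc, hc'⟩ := exists_unique_monicVanishing (hDfin t)
      simp only [Set.mem_iUnion]
      refine ⟨n, c, fun j _ => ⟨t, ⟨c, hc, rfl⟩, fun c' h => by rw [hc' c' h]⟩, hc d hd⟩
    · exact Set.countable_iUnion fun n => (Set.Finite.pi fun j => hGfin n j).countable.biUnion
          fun c _ => (finite_monic_roots c).countable

end Finiteness

/-! ## Uniformly bounded sets of centers -/

section Centers

variable {E : Lang.{u}} {l : List Srt}

/-- The difference of two terms in the valued field. -/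
def Term.sub {ctx : List Srt} (t t' : Term (DPLang E) ctx .VF) : Term (DPLang E) ctx .VF :=
  .app (a := [.VF, .VF]) (Sum.inl DPFn.addK) (Tuple.cons t (Tuple.cons
    (.app (a := [.VF]) (Sum.inl DPFn.negK) (Tuple.cons t' Tuple.nil)) Tuple.nil))

/-- The angular component of a term. -/
def Term.ac {ctx : List Srt} (t : Term (DPLang E) ctx .VF) : Term (DPLang E) ctx .RF :=
  .app (a := [.VF]) (Sum.inl DPFn.ac) (Tuple.cons t Tuple.nil)

/-- The order of a term. -/
def Term.ord {ctx : List Srt} (t : Term (DPLang E) ctx .VF) : Term (DPLang E) ctx .VG :=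
  .app (a := [.VF]) (Sum.inl DPFn.ord) (Tuple.cons t Tuple.nil)

/-- The formula in `(c, x, z)` saying that all `y` with the same order and angular component of
`y - c` as of `x - c` satisfy `(y, z) ∈ X`. -/
def cellFormula (X : Formula (DPLang E) (.VF :: l)) : Formula (DPLang E) (.VF :: .VF :: l) :=
  let y : Term (DPLang E) (.VF :: .VF :: .VF :: l) .VF :=
    .var (ctx := .VF :: .VF :: .VF :: l) (0 : Fin (l.length + 3))
  let c : Term (DPLang E) (.VF :: .VF :: .VF :: l) .VF :=
    .var (ctx := .VF :: .VF :: .VF :: l) (1 : Fin (l.length + 3))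
  let x : Term (DPLang E) (.VF :: .VF :: .VF :: l) .VF :=
    .var (ctx := .VF :: .VF :: .VF :: l) (2 : Fin (l.length + 3))
  .all .VF (.imp (.eq (y.sub c).ac (x.sub c).ac) (.imp (.eq (y.sub c).ord (x.sub c).ord)
    (X.subst (liftSubst .VF fun i => .var (ctx := .VF :: .VF :: l) i.succ.succ))))

/-- The fiber of `X` over `z` is a union of cells with at most `Q` centers. -/
def HasCenters {K k Γ : Type u} (M : Interp (DPLang E) K k Γ) (X : Formula (DPLang E) (.VF :: l))
    (z : Tuple (Carrier K k Γ) l) (Q : ℕ) : Prop :=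
  ∃ C : Finset K, C.card ≤ Q ∧ ∀ x : K, X.Realize M (Tuple.cons (s := .VF) x z) →
    ∃ c ∈ C, (cellFormula X).Realize M (Tuple.cons (s := .VF) c (Tuple.cons (s := .VF) x z))

theorem cons_mem_graphTo {K k Γ : Type u} {l : List Srt} (c : Tuple (Carrier K k Γ) l → K) (y : K)
    (t : Tuple (Carrier K k Γ) l) : Tuple.cons (s := .VF) y t ∈ graphTo c ↔ y = c t := by
  constructor
  · rintro ⟨t', h⟩
    have h0 : y = c t' := congrFun h ⟨0, Nat.succ_pos _⟩
    have h1 : t = t' := funext fun i => congrFun h i.succ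
    rw [h0, h1]
  · rintro rfl
    exact ⟨t, rfl⟩

section Model

variable {K k Γ : Type u} [Field K] [Field k] [AddCommGroup Γ] [LinearOrder Γ]
  [IsOrderedAddMonoid Γ] {V : AcValued K k Γ} {M : Interp (DPLang E) K k Γ}

theorem Term.eval_sub (hM : M.Expands V) {ctx : List Srt} (t t' : Term (DPLang E) ctx .VF)
    (v : Tuple (Carrier K k Γ) ctx) {x y : K} (hx : t.eval M v = x) (hy : t'.eval M v = y) :
    (t.sub t').eval M v = (x - y : K) := by
  have h : (Term.app (a := [.VF]) (Sum.inl DPFn.negK) (Tuple.cons t' Tuple.nil) :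
      Term (DPLang E) ctx .VF).eval M v = (-y : K) :=
    (hM.1 _ _ _ _).trans (congrArg (fun y : K => -y) hy)
  exact (hM.1 _ _ _ _).trans ((congrArg₂ (fun x y : K => x + y) hx h).trans
    (sub_eq_add_neg x y).symm)

theorem Term.eval_ac (hM : M.Expands V) {ctx : List Srt} (t : Term (DPLang E) ctx .VF)
    (v : Tuple (Carrier K k Γ) ctx) {x : K} (hx : t.eval M v = x) : t.ac.eval M v = V.ac x :=
  (hM.1 _ _ _ _).trans (congrArg V.ac hx)

theorem Term.eval_ord (hM : M.Expands V) {ctx : List Srt} (t : Term (DPLang E) ctx .VF)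
    (v : Tuple (Carrier K k Γ) ctx) {x : K} (hx : t.eval M v = x) :
    t.ord.eval M v = WithTop.untopD (0 : Γ) (V.v x) :=
  (hM.1 _ _ _ _).trans (congrArg (fun x : K => WithTop.untopD (0 : Γ) (V.v x)) hx)

theorem realize_cellFormula (hM : M.Expands V) (X : Formula (DPLang E) (.VF :: l)) (c x : K)
    (z : Tuple (Carrier K k Γ) l) :
    (cellFormula X).Realize M (Tuple.cons (s := .VF) c (Tuple.cons (s := .VF) x z)) ↔
      ∀ y : K, V.ac (y - c) = V.ac (x - c) →
        WithTop.untopD (0 : Γ) (V.v (y - c)) = WithTop.untopD (0 : Γ) (V.v (x - c)) →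
        X.Realize M (Tuple.cons (s := .VF) y z) := by
  refine forall_congr' fun y => imp_congr ?_ (imp_congr ?_ ?_)
  · exact iff_of_eq (congrArg₂ Eq
      (Term.eval_ac hM _ _ (Term.eval_sub hM _ _ _ (x := y) (y := c) rfl rfl))
      (Term.eval_ac hM _ _ (Term.eval_sub hM _ _ _ (x := x) (y := c) rfl rfl)))
  · exact iff_of_eq (congrArg₂ Eq
      (Term.eval_ord hM _ _ (Term.eval_sub hM _ _ _ (x := y) (y := c) rfl rfl))
      (Term.eval_ord hM _ _ (Term.eval_sub hM _ _ _ (x := x) (y := c) rfl rfl)))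
  · rw [Formula.realize_subst, eval_liftSubst]
    exact Iff.rfl

/-- Elements of the sorts of `M` are values of terms in elements of the valued field. -/
theorem exists_terms_in_VF (hM : M.Expands V) : ∀ {l : List Srt} (z : Tuple (Carrier K k Γ) l),
    ∃ a : Tuple (Carrier K k Γ) (List.replicate l.length .VF), ∀ i : Fin l.length,
      ∃ t : Term (DPLang E) (List.replicate l.length .VF) (l.get i), t.eval M a = z i
  | [], z => ⟨Tuple.nil, fun i => i.elim0⟩
  | s :: l, z => by
    obtain ⟨a, ha⟩ := exists_terms_in_VF hM (l := l) (fun i => z i.succ)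
    let z₀ : Carrier K k Γ s := z ⟨0, Nat.succ_pos _⟩
    have key : ∀ x : K, (∃ t : Term (DPLang E) (.VF :: List.replicate l.length .VF) s,
        t.eval M (Tuple.cons (s := .VF) x a) = z₀) → ∃ a' : Tuple (Carrier K k Γ)
          (List.replicate (s :: l).length .VF), ∀ i : Fin (s :: l).length,
          ∃ t : Term (DPLang E) (List.replicate (s :: l).length .VF) ((s :: l).get i),
            t.eval M a' = z i := by
      intro x hx
      refine ⟨Tuple.cons (s := .VF) x a, fun i => ?_⟩
      refine Fin.cases (motive := fun i : Fin (l.length + 1) => ∃ t : Term (DPLang E)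
        (.VF :: List.replicate l.length .VF) ((s :: l).get i),
          t.eval M (Tuple.cons (s := .VF) x a) = z i) hx (fun i => ?_) i
      obtain ⟨t, ht⟩ := ha i
      exact ⟨t.weaken .VF, (t.eval_weaken M _ _).trans ht⟩
    let x₀ : Term (DPLang E) (.VF :: List.replicate l.length .VF) .VF :=
      .var (ctx := .VF :: List.replicate l.length .VF)
        (0 : Fin ((List.replicate l.length Srt.VF).length + 1))
    cases s with
    | VF => exact key z₀ ⟨x₀, rfl⟩
    | RF =>
      obtain ⟨x, hx⟩ := V.ac_surjective z₀
      exact key x ⟨x₀.ac, (x₀.eval_ac hM _ rfl).trans hx⟩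
    | VG =>
      obtain ⟨x, hx⟩ := V.ord_surjective z₀
      exact key x ⟨x₀.ord, (x₀.eval_ord hM _ rfl).trans hx⟩

theorem exists_hasCenters (hM : M.Expands V) (hb : FinitelyBMinimalIn V M)
    (hsat : ∀ (l m : List Srt) (a : Tuple (Carrier K k Γ) m)
      (φ : Formula (DPLang E) (.VF :: (l ++ m))),
      {y : K | ∃ t : Tuple (Carrier K k Γ) l,
        φ.Realize M (Tuple.cons (s := .VF) y (t.append a))}.Countable →
      {y : K | ∃ t : Tuple (Carrier K k Γ) l,
        φ.Realize M (Tuple.cons (s := .VF) y (t.append a))}.Finite)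
    (X : Formula (DPLang E) (.VF :: l)) (z : Tuple (Carrier K k Γ) l) :
    ∃ Q, HasCenters M X z Q := by
  classical
  -- b-minimality only allows parameters in the valued field, so `z` is replaced by field elements
  -- from which terms recover it.
  obtain ⟨a, ha⟩ := exists_terms_in_VF hM z
  choose t ht using ha
  have hdef : M.DefinableOver a
      (single k Γ '' {x : K | X.Realize M (Tuple.cons (s := .VF) x z)}) := by
    refine ⟨X.subst (liftSubst .VF t), fun p => ?_⟩
    have hp : p = single k Γ (p (0 : Fin 1) : K) := by
      funext i
      change Fin 1 at i
      fin_cases i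
      rfl
    have h1 : (X.subst (liftSubst .VF t)).Realize M (p.append a) ↔
        X.Realize M (Tuple.cons (s := .VF) (p (0 : Fin 1) : K) z) := by
      rw [← funext ht, ← eval_liftSubst, ← Formula.realize_subst]
      exact Iff.rfl
    refine Iff.trans ⟨?_, fun h => ⟨_, h, hp.symm⟩⟩ h1.symm
    rintro ⟨x, hx, rfl⟩
    exact hx
  obtain ⟨r, t, f, c, -, ⟨φ, hφ⟩, hcell⟩ := hb.2 _ a _ hdef
  have hφ' : ∀ (s : Tuple (Carrier K k Γ) (List.replicate r .RF ++ List.replicate t .VG)) (y : K),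
      φ.Realize M (Tuple.cons (s := .VF) y (s.append a)) ↔ y = c s := fun s y =>
    (hφ (Tuple.cons (s := .VF) y s)).symm.trans (cons_mem_graphTo c y s)
  -- The graph of `c` is a functional relation on `k^r × Γ^t`, so the centers form a finite set.
  have hfin := finite_of_functional hM hb.1 hsat
    (List.replicate r Srt.RF ++ List.replicate t Srt.VG)
    (by
      intro s hs
      rcases List.mem_append.1 hs with h | h <;> rw [List.eq_of_mem_replicate h] <;> simp)
    _ a φ (fun s y y' h h' => ((hφ' s y).1 h).trans ((hφ' s y').1 h').symm)
  refine ⟨_, hfin.toFinset, le_rfl, fun x hx => ⟨c (f x), hfin.mem_toFinset.2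
    ⟨f x, (hφ' _ _).2 rfl⟩, (realize_cellFormula hM X _ _ z).2 fun y hac hord => ?_⟩⟩
  rcases hcell (f x) ⟨x, hx, rfl⟩ with h | ⟨ξ, η, h⟩
  · have hxc : x = c (f x) := h.subset (show x ∈ _ ∩ f ⁻¹' {f x} from ⟨hx, rfl⟩)
    -- `ac` vanishes only at `0`, so the condition on `ac` alone isolates a singleton cell.
    rw [← hxc, sub_self, map_zero, map_eq_zero, sub_eq_zero] at hac
    rwa [hac]
  · obtain ⟨hxc, hξ, hη⟩ := h.subset (show x ∈ _ ∩ f ⁻¹' {f x} from ⟨hx, rfl⟩)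
    have hyc : y ≠ c (f x) := by
      rintro h
      rw [h, sub_self, map_zero, eq_comm, map_eq_zero, sub_eq_zero] at hac
      exact hxc hac
    refine (h.superset (show y ∈ _ from ⟨hyc, hac.trans hξ, ?_⟩)).1
    -- The total function `ord` takes the value `0` at `0`; as `y - c (f x)` is nonzero, equality of
    -- orders is here equality of valuations.
    obtain ⟨γ, hγ⟩ := WithTop.ne_top_iff_exists.1
      (mt (AddValuation.top_iff V.v).1 (sub_ne_zero.2 hyc))
    rw [← hγ, hη] at hord
    rw [← hγ]
    exact congrArg _ hord

end Model

/-- Centers in one of the structures, from centers in an ultraproduct. -/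
theorem exists_frequently_hasCenters (T : Set (Sentence (DPLang E))) (hH : ContainsH T)
    (hstar : PropertyStar T) (A : ℕ → Str (DPLang E)) [∀ n s, Nonempty ((A n).carrier s)]
    (hA : ∀ σ ∈ T, ∀ᶠ n in Filter.atTop, Formula.Realize (A n).interp σ Tuple.nil)
    (X : Formula (DPLang E) (.VF :: l)) (z : ∀ n, Tuple (A n).carrier l) :
    ∃ Q, ∃ᶠ n in Filter.atTop, HasCenters (A n).interp X (z n) Q := by
  classical
  let U : Ultrafilter ℕ := Filter.hyperfilter ℕ
  have hU : (U : Filter ℕ) ≤ Filter.atTop := Nat.hyperfilter_le_atTop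
  have hmod : (ultraInterp U A).Models T := by
    intro σ hσ
    have h := (realize_ultraTuple U σ fun n => Tuple.nil (C := (A n).carrier)).2 (hU (hA σ hσ))
    rwa [show ultraTuple U (fun n => Tuple.nil (C := (A n).carrier)) = Tuple.nil from
      funext fun i => i.elim0] at h
  obtain ⟨_, _, _, _, _, V, hM, -, -⟩ := hH _ _ _ _ hmod
  obtain ⟨Q, C, hCQ, hC⟩ := exists_hasCenters hM (hstar _ _ _ V _ hM hmod).2.1
    (fun l m a φ => finite_of_countable_ultra U hU a φ) X (ultraTuple U z)
  refine ⟨Q, Filter.Frequently.filter_mono (Filter.Eventually.frequently ?_) hU⟩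
  by_contra hne
  rw [← Ultrafilter.eventually_not] at hne
  -- Representatives of the centers are the candidates at index `n`. Some may coincide there, which
  -- only lowers the cardinality.
  let C' (n : ℕ) : Finset (A n).K :=
    C.image fun c => ultraRep (A := A) (s := .VF) (U := U) c n
  -- Where the candidates fail, `x n` is a point of the fiber for which none of them is suitable.
  -- The class of `x` does have a suitable center, which contradicts this through Łoś.
  have : ∀ n, ∃ x : (A n).K, ¬ HasCenters (A n).interp X (z n) Q →
      X.Realize (A n).interp (Tuple.cons (s := .VF) x (z n)) ∧ ∀ c ∈ C' n,
        ¬ (cellFormula X).Realize (A n).interp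
          (Tuple.cons (s := .VF) c (Tuple.cons (s := .VF) x (z n))) := by
    intro n
    by_cases hn : HasCenters (A n).interp X (z n) Q
    · exact ⟨Classical.arbitrary ((A n).carrier .VF), fun h => absurd hn h⟩
    · by_contra! h
      exact hn ⟨C' n, Finset.card_image_le.trans hCQ, fun x hx => (h x).2 hx⟩
  choose x hx using this
  let x' : ∀ n, (A n).carrier .VF := x
  have hxX : X.Realize (ultraInterp U A) (Tuple.cons (ultraMk U x') (ultraTuple U z)) := by
    rw [← ultraTuple_cons, realize_ultraTuple]
    exact hne.mono fun n hn => (hx n hn).1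
  obtain ⟨c, hc, hcx⟩ := hC _ hxX
  let c' : UltraCarrier U A .VF := c
  have hcx' : (cellFormula X).Realize (ultraInterp U A) (Tuple.cons (ultraMk U (ultraRep c'))
      (Tuple.cons (ultraMk U x') (ultraTuple U z))) := by
    rw [ultraMk_rep]
    exact hcx
  rw [← ultraTuple_cons, ← ultraTuple_cons, realize_ultraTuple] at hcx'
  obtain ⟨n, h1, h2⟩ := (hcx'.and hne).exists
  exact (hx n h2).2 _ (Finset.mem_image_of_mem _ hc) h1

/-- Uniformly in all local fields of large residue characteristic and in all parameters, the
fibers of `X` are unions of cells with boundedly many centers. -/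
theorem exists_uniform_hasCenters (T : Set (Sentence (DPLang E))) (hH : ContainsH T)
    (hstar : PropertyStar T) (𝔖 : LocalEquipment E) (hstarstar : PropertyStarStar T 𝔖)
    (X : Formula (DPLang E) (.VF :: l)) :
    ∃ N : ℕ, ∀ (K : Type u) [Field K] [ValuativeRel K] [TopologicalSpace K]
      [IsNonarchimedeanLocalField K], N ≤ ringChar 𝓀[K] → ∀ S ∈ 𝔖.structures K,
      ∀ z : Tuple (Carrier K 𝓀[K] (ULift.{u} ℤ)) l, HasCenters S.interp X z N := by
  by_contra! hcon
  -- Of the `n`-th counterexample only its structure is kept, with the fact that it satisfies every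
  -- sentence valid in all local fields of residue characteristic at least some `N ≤ n`. By (∗∗),
  -- each sentence of `T` then holds from some index on.
  have : ∀ n : ℕ, ∃ (A : Str (DPLang E)) (z : Tuple A.carrier l), (∀ s, Nonempty (A.carrier s)) ∧
      (∀ σ, ∀ N ≤ n, (∀ (K : Type u) [Field K] [ValuativeRel K] [TopologicalSpace K]
        [IsNonarchimedeanLocalField K], N ≤ ringChar 𝓀[K] → ∀ S ∈ 𝔖.structures K,
        S.interp.Models {σ}) → Formula.Realize A.interp σ Tuple.nil) ∧
      ¬ HasCenters A.interp X z n := by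
    intro n
    obtain ⟨K, i₁, i₂, i₃, i₄, hK, S, hS, z, hz⟩ := hcon n
    refine ⟨⟨K, 𝓀[K], ULift.{u} ℤ, S.interp⟩, z, ?_, ?_, hz⟩
    · rintro (_ | _ | _)
      · exact ⟨(0 : K)⟩
      · exact ⟨(0 : 𝓀[K])⟩
      · exact ⟨(0 : ULift.{u} ℤ)⟩
    · intro σ N hN h
      exact h K (hN.trans hK) S hS σ rfl
  choose A z hne hA hz using this
  obtain ⟨Q, hQ⟩ := exists_frequently_hasCenters T hH hstar A (fun σ hσ => by
    obtain ⟨N, hN⟩ := hstarstar {σ} (Set.singleton_subset_iff.2 hσ) (Set.finite_singleton σ)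
    exact (Filter.eventually_ge_atTop N).mono fun n hn => hA n σ N hn hN) X z
  -- `Q` is fixed, while the `n`-th counterexample has no set of at most `n` centers; any suitable
  -- `n ≥ Q` contradicts this.
  obtain ⟨n, ⟨C, hCQ, hC⟩, hn⟩ := (hQ.and_eventually (Filter.eventually_ge_atTop Q)).exists
  exact hz n ⟨C, hCQ.trans hn, hC⟩

end Centers

/-! ## Balls in local fields -/

section LocalBalls

open ValuativeRel MeasureTheory

variable {K : Type u} [Field K] [ValuativeRel K]

/-- The set `a + b 𝒪_K`: a ball, or a singleton if `b = 0`. -/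
def coset (a b : K) : Set K := {x | ∃ y ∈ 𝒪[K], x = a + b * y}

theorem self_mem_coset (a b : K) : a ∈ coset a b := ⟨0, zero_mem _, by simp⟩

variable [TopologicalSpace K] [IsNonarchimedeanLocalField K]

theorem mem_coset {a b x : K} : x ∈ coset a b ↔ localVal K b ≤ localVal K (x - a) := by
  constructor
  · rintro ⟨y, hy, rfl⟩
    rw [add_sub_cancel_left, AddValuation.map_mul]
    exact le_add_of_nonneg_right ((mem_localVal_integer K y).2 hy)
  · intro h
    by_cases hb : b = 0
    · rw [hb, AddValuation.map_zero, top_le_iff, AddValuation.top_iff, sub_eq_zero] at h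
      exact ⟨0, zero_mem _, by rw [h, mul_zero, add_zero]⟩
    · refine ⟨(x - a) / b, (mem_localVal_integer K _).1 ?_, by field_simp; ring⟩
      have hb' : localVal K b ≠ ⊤ := mt (AddValuation.top_iff _).1 hb
      have h1 : localVal K (x - a) = localVal K b + localVal K ((x - a) / b) := by
        rw [← AddValuation.map_mul, mul_div_cancel₀ _ hb]
      rw [h1] at h
      change 0 ≤ localVal K ((x - a) / b)
      obtain ⟨β, hβ⟩ := WithTop.ne_top_iff_exists.1 hb'
      by_contra hlt
      obtain ⟨δ, hδ⟩ := WithTop.ne_top_iff_exists.1 (not_le.1 hlt).ne_top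
      rw [← hβ, ← hδ] at h
      rw [← hδ] at hlt
      have h2 : β ≤ β + δ := by exact_mod_cast h
      exact hlt (by exact_mod_cast (le_add_iff_nonneg_right β).1 h2)

theorem coset_eq_of_mem {a b x : K} (hx : x ∈ coset a b) : coset a b = coset x b := by
  rw [mem_coset] at hx
  ext y
  rw [mem_coset, mem_coset]
  constructor <;> intro h
  · have := (localVal K).map_sub (y - a) (x - a)
    rw [sub_sub_sub_cancel_right] at this
    exact (le_min h hx).trans this
  · have := (localVal K).map_add (y - x) (x - a)
    rw [sub_add_sub_cancel] at this
    exact (le_min h hx).trans this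

theorem coset_subset_coset {a b b' : K} (h : localVal K b ≤ localVal K b') :
    coset a b' ⊆ coset a b := fun _ hx => mem_coset.2 (h.trans (mem_coset.1 hx))

theorem coset_zero (a : K) : coset a 0 = {a} := by
  ext x
  rw [mem_coset, AddValuation.map_zero, top_le_iff, AddValuation.top_iff, sub_eq_zero,
    Set.mem_singleton_iff]

variable (K) in
-- The Hausdorff property makes compact cosets closed, hence measurable.
theorem t2Space_localField : T2Space K := by
  refine IsTopologicalAddGroup.t2Space_of_zero_sep fun x hx =>
    ⟨{y | valuation K y < valuation K x}, (IsValuativeTopology.mem_nhds_zero_iff _).2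
      ⟨Units.mk0 (valuation K x) (by simpa using hx), fun y hy => by simpa using hy⟩, ?_⟩
  simp

theorem isCompact_coset (a b : K) : IsCompact (coset a b) := by
  have h : coset a b = (fun y => a + b * y) '' (𝒪[K] : Set K) := by
    ext x
    exact ⟨fun ⟨y, hy, h⟩ => ⟨y, hy, h.symm⟩, fun ⟨y, hy, h⟩ => ⟨y, hy, h.symm⟩⟩
  rw [h]
  exact (IsNonarchimedeanLocalField.isCompact_closedBall K 1).image (by fun_prop)

theorem isOpen_coset (a : K) {b : K} (hb : b ≠ 0) : IsOpen (coset a b) := by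
  have h : coset a b = (fun x => b⁻¹ * (x - a)) ⁻¹' (𝒪[K] : Set K) := by
    ext x
    constructor
    · rintro ⟨y, hy, rfl⟩
      simpa [hb] using hy
    · intro hx
      exact ⟨_, hx, by field_simp; ring⟩
  rw [h]
  exact Valuation.isOpen_integer.preimage (by fun_prop)

/-- A smaller coset has smaller volume. -/
theorem vol_coset_lt {a b a' b' : K} (hb : b ≠ 0) (h : coset a' b' ⊂ coset a b) :
    vol (coset a' b') < vol (coset a b) := by
  let _ : MeasurableSpace K := borel K
  have : BorelSpace K := ⟨rfl⟩
  have := t2Space_localField K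
  have : Measure.IsAddHaarMeasure (haar K) := by unfold haar; infer_instance
  change haar K (coset a' b') < haar K (coset a b)
  obtain ⟨hsub, p, hp, hp'⟩ := Set.ssubset_iff_exists.1 h
  have ha : coset a b = coset a' b := coset_eq_of_mem (hsub (self_mem_coset a' b'))
  have hbb : localVal K b ≤ localVal K b' := by
    by_contra hlt
    rw [ha] at hp
    exact hp' (coset_subset_coset (not_le.1 hlt).le hp)
  -- The translate of the smaller coset through a missed point `p` is disjoint from it and still
  -- lies in the larger one, which therefore has at least twice its volume.
  have hdisj : Disjoint (coset a' b') (coset p b') := by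
    refine Set.disjoint_left.2 fun w hw hw' => hp' ?_
    rw [coset_eq_of_mem hw, ← coset_eq_of_mem hw']
    exact self_mem_coset p b'
  have htr : haar K (coset p b') = haar K (coset a' b') := by
    rw [← measure_preimage_add (haar K) (a' - p) (coset a' b')]
    congr 1
    ext x
    rw [Set.mem_preimage, mem_coset, mem_coset]
    ring_nf
  have hle : haar K (coset a' b') + haar K (coset a' b') ≤ haar K (coset a b) := by
    nth_rewrite 2 [← htr]
    rw [← measure_union hdisj (isCompact_coset p b').isClosed.measurableSet]
    refine measure_mono (Set.union_subset hsub ?_)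
    rw [coset_eq_of_mem hp]
    exact coset_subset_coset hbb
  -- Doubling says nothing about a null coset, such as a singleton; then the larger coset wins by
  -- being open and nonempty.
  by_cases h0 : haar K (coset a' b') = 0
  · rw [h0]
    exact (isOpen_coset a hb).measure_pos _ ⟨a, self_mem_coset a b⟩
  · exact (ENNReal.lt_add_right (isCompact_coset a' b').measure_lt_top.ne h0).trans_le hle

/-- Of two intersecting cosets, the one of smaller volume is contained in the other. -/
theorem coset_subset_of_vol_le {a b a' b' x : K} (hb : b ≠ 0) (hx : x ∈ coset a b)
    (hx' : x ∈ coset a' b') (h : vol (coset a b) ≤ vol (coset a' b')) :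
    coset a b ⊆ coset a' b' := by
  rcases le_total (localVal K b') (localVal K b) with hle | hle
  · rw [coset_eq_of_mem hx, coset_eq_of_mem hx']
    exact coset_subset_coset hle
  · by_contra hne
    have hsub : coset a' b' ⊆ coset a b := by
      rw [coset_eq_of_mem hx, coset_eq_of_mem hx']
      exact coset_subset_coset hle
    exact absurd h (not_le.2 (vol_coset_lt hb ⟨hsub, hne⟩))

/-- Two points of a ball are closer to each other than to any point outside it. -/
theorem lt_localVal_of_notMem_coset {a b c x y : K} (hc : c ∉ coset a b) (hx : x ∈ coset a b)
    (hy : y ∈ coset a b) : localVal K (x - c) < localVal K ((y - c) - (x - c)) := by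
  rw [coset_eq_of_mem hx, mem_coset] at hc hy
  rw [sub_sub_sub_cancel_right, AddValuation.map_sub_swap]
  exact (not_le.1 hc).trans_le hy

/-- If `X ⊆ 𝒪_K` is a union of cells with centers in `C`, then each ball that meets the multibox of
`X` without being contained in it contains an element of `C`. -/
theorem exists_center_mem_of_boundaryBall {ϖ : K} (hϖ : localVal K ϖ = toVal 1) {X : Set K}
    (hX : X ⊆ (𝒪[K] : Set K)) {C : Set K}
    (hC : ∀ x ∈ X, ∃ c ∈ C, ∀ y : K, localAc hϖ (y - c) = localAc hϖ (x - c) →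
      WithTop.untopD 0 (localVal K (y - c)) = WithTop.untopD 0 (localVal K (x - c)) → y ∈ X)
    {B : Set K} (hB : B ∈ boundaryBalls (multibox X)) : ∃ c ∈ C, c ∈ B := by
  obtain ⟨⟨a, b, hb, rfl : B = coset a b⟩, ⟨x, hxB, Y, ⟨⟨hYO, hY⟩, hYX, hYmax⟩, hxY⟩, hBX⟩ := hB
  by_contra! hCB
  obtain ⟨c, hc, hcX⟩ := hC x (hYX hxY)
  -- Seen from the center `c` outside the ball, all its points have the same order and angular
  -- component as `x`.
  have hsub : coset a b ⊆ X := fun y hy => by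
    have hlt := lt_localVal_of_notMem_coset (hCB c hc) hxB hy
    exact hcX y ((localAcValued hϖ).ac_eq_of_lt hlt) (by
      rw [show localVal K (y - c) = localVal K (x - c) from (localAcValued hϖ).v_eq_of_lt hlt])
  -- The ball now competes in the definition of the multibox, so it is no larger than `Y`; meeting
  -- `Y` at `x`, it lies in `Y`.
  have hvol := hYmax (coset a b) ⟨hsub.trans hX, Or.inr ⟨a, b, hb, rfl⟩⟩ hsub
  have hY' : ∃ a' b', Y = coset a' b' := by
    rcases hY with ⟨a', rfl⟩ | ⟨a', b', -, rfl⟩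
    · exact ⟨a', 0, (coset_zero a').symm⟩
    · exact ⟨a', b', rfl⟩
  obtain ⟨a', b', rfl⟩ := hY'
  exact hBX ((coset_subset_of_vol_le hb hxB hxY hvol).trans fun y hy =>
    ⟨_, ⟨⟨hYO, hY⟩, hYX, hYmax⟩, hy⟩)

/-- Choosing a point of `C` in each ball is injective on minimal ones: two minimal balls have equal
volume, and if they share a point each contains the other. -/
theorem encard_minimalBoundaryBalls_le {A : Set K} {C : Finset K}
    (hC : ∀ B ∈ boundaryBalls A, ∃ c ∈ C, c ∈ B) :
    (minimalBoundaryBalls A).encard ≤ C.card := by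
  classical
  choose! f hfC hfB using hC
  rw [← Set.encard_coe_eq_coe_finsetCard]
  refine Set.encard_le_encard_of_injOn (f := f) (fun B hB => hfC B hB.1) ?_
  intro B hB B' hB' hBB
  have h1 := hfB B hB.1
  have h2 := hfB B' hB'.1
  rw [← hBB] at h2
  have hle := hB.2 B' hB'.1
  have hle' := hB'.2 B hB.1
  obtain ⟨a, b, hb, rfl : B = coset a b⟩ := hB.1.1
  obtain ⟨a', b', hb', rfl : B' = coset a' b'⟩ := hB'.1.1
  exact (coset_subset_of_vol_le hb h1 h2 hle).antisymm (coset_subset_of_vol_le hb' h2 h1 hle')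

end LocalBalls

end DPas

theorem mainTheorem5 (E : DPas.Lang.{u}) (T : Set (DPas.Sentence (DPas.DPLang E)))
    (hH : DPas.ContainsH T) (hstar : DPas.PropertyStar T)
    (𝔖 : DPas.LocalEquipment E) (hstarstar : DPas.PropertyStarStar T 𝔖)
    (l : List DPas.Srt) (Z : DPas.Formula (DPas.DPLang E) l)
    (X : DPas.Formula (DPas.DPLang E) (.VF :: l))
    (hX : ∃ M₀ : ℕ, ∀ (K : Type u) [Field K] [ValuativeRel K] [TopologicalSpace K]
      [IsNonarchimedeanLocalField K], M₀ ≤ ringChar 𝓀[K] → ∀ S ∈ 𝔖.structures K,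
      ∀ (x : K) (z : DPas.Tuple (DPas.Carrier K 𝓀[K] (ULift.{u} ℤ)) l),
        x ∈ S.fiber X z → x ∈ 𝒪[K] ∧ z ∈ S.points Z) :
    ∃ M Q : ℕ, 0 < M ∧ 0 < Q ∧
      ∀ (K : Type u) [Field K] [ValuativeRel K] [TopologicalSpace K]
        [IsNonarchimedeanLocalField K], M ≤ ringChar 𝓀[K] → ∀ S ∈ 𝔖.structures K,
        ∀ z ∈ S.points Z,
          (DPas.minimalBoundaryBalls (DPas.multibox (S.fiber X z))).encard ≤ Q := by
  obtain ⟨M₀, hM₀⟩ := hX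
  obtain ⟨N, hN⟩ := DPas.exists_uniform_hasCenters T hH hstar 𝔖 hstarstar X
  -- The bounds come from `max M₀ N` and `N`; adding `1` only ensures positivity.
  refine ⟨max M₀ N + 1, N + 1, Nat.succ_pos _, Nat.succ_pos _, ?_⟩
  intro K _ _ _ _ hK S hS z _
  obtain ⟨C, hCN, hC⟩ := hN K (((le_max_right _ _).trans (Nat.le_succ _)).trans hK) S hS z
  refine (DPas.encard_minimalBoundaryBalls_le (C := C) fun B hB =>
    DPas.exists_center_mem_of_boundaryBall S.uniformizer (C := (C : Set K))
      (fun x hx => (hM₀ K (((le_max_left _ _).trans (Nat.le_succ _)).trans hK) S hS x z hx).1)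
      (fun x hx => ?_) hB).trans (by exact_mod_cast hCN.trans (Nat.le_succ N))
  obtain ⟨c, hc, h⟩ := hC x hx
  exact ⟨c, hc, (DPas.realize_cellFormula S.expands X c x z).1 h⟩
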